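/- Consider the two-user additive white Gaussian noise multiple-access channel $Y_t = X_{1,t}+X_{2,t}+Z_t$, where $Z_1,Z_2,\dots$ are i.i.d. centred Gaussian of variance $N$. The messages $M_1,M_2$ are independent, uniformly distributed over finite nonempty sets $\mathcal M_1,\mathcal M_2$, and independent of the noise. In the *no-feedback* setting a blocklength-$n$ code has inputs $X_{1,t}$ and $X_{2,t}$ ($1\le t\le n$) that are functions of $M_1$ and of $M_2$, respectively. In the *noisy partial feedback* setting $X_{1,t}$ is a function of $M_1$ only, while $X_{2,t}$ is a function of $(M_2,V_1,\dots,V_{t-1})$, where $V_t=Y_t+W_t$ and $W_1,W_2,\dots$ are i.i.d. centred Gaussian of variance $\sigma_2^2$, independent of $(M_1,M_2,\{Z_t\})$. In both settings the inputs satisfy the power constraints $\frac1n\sum_{t=1}^n \mathbb E[X_{\nu,t}^2]\le P_\nu$ for $\nu\in\{1,2\}$, and the decoder is a function $\phi^{(n)}:\mathbb R^n\to\mathcal M_1\times\mathcal M_2$ of $Y_1,\dots,Y_n$. A pair $(R_1,R_2)$ of nonnegative reals is achievable if for every $\delta>0$ there are, for all sufficiently large $n$, blocklength-$n$ codes with $\frac1n\log|\mathcal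 M_\nu|>R_\nu-\delta$ for $\nu\in\{1,2\}$ whose average error probability $\Pr[\phi^{(n)}(Y_1,\dots,Y_n)\ne(M_1,M_2)]$ tends to $0$ as $n\to\infty$. The capacity region is the set of all achievable pairs; write $\mathcal C_{\mathrm{MAC}}(P_1,P_2,N)$ for it in the no-feedback setting and $\mathcal C_{\mathrm{NoisyPartialFB}}(P_1,P_2,N,\sigma_2^2)$ in the noisy partial feedback setting. **Theorem (Noisy Partial Feedback is Always Beneficial).** For all $N,P_1,P_2>0$ and every $\sigma_2^2\ge 0$, $$\mathcal C_{\mathrm{MAC}}(P_1,P_2,N)\subset \mathcal C_{\mathrm{NoisyPartialFB}}(P_1,P_2,N,\sigma_2^2),$$ and the inclusion is strict. Moreover, $\mathcal C_{\mathrm{NoisyPartialFB}}(P_1,P_2,N,\sigma_2^2)$ contains a rate pair $(R_1,R_2)$ with $$R_1+R_2>\tfrac12\log\Bigl(1+\frac{P_1+P_2}{N}\Bigr).$$ -/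

import Mathlib

open MeasureTheory ProbabilityTheory Filter Topology
open scoped NNReal ENNReal

namespace GaussianMAC

/-- The law of `n` independent zero-mean Gaussian random variables of variance `v`
(a point mass at `0` when `v = 0`). -/
noncomputable def noiseLaw (n : ℕ) (v : ℝ≥0) : Measure (Fin n → ℝ) :=
  Measure.pi fun _ => gaussianReal 0 v

/-- The law of two independent messages, uniformly distributed over message sets of sizes
`k₁` and `k₂`. -/
noncomputable def messageLaw (k₁ k₂ : ℕ) : Measure (Fin k₁ × Fin k₂) :=
  (uniformOn (Set.univ : Set (Fin k₁))).prod (uniformOn (Set.univ : Set (Fin k₂)))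

/-- The expected average block-power constraint `(1/n) ∑ₜ E[Xₜ²] ≤ P`. The expectations are
taken in `[0, ∞]`, so inputs of infinite power are not admitted. -/
def PowerConstraint {Ω : Type*} [MeasurableSpace Ω] (μ : Measure Ω) {n : ℕ}
    (X : Fin n → Ω → ℝ) (P : ℝ≥0) : Prop :=
  (n : ℝ≥0∞)⁻¹ * ∑ t, ∫⁻ ω, ENNReal.ofReal (X t ω ^ 2) ∂μ ≤ P

/-! ### Noisy partial feedback -/

/-- Encoders and decoder of blocklength `n` for the two-user multiple-access channel with
feedback to Transmitter 2 only. The inputs of Transmitter 1 depend on its message only; the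
time-`t` input of Transmitter 2 depends on its message and on the feedback outputs at the times
before `t` (time is `0, …, n - 1`). -/
structure PartialFeedbackCode (n : ℕ) where
  /-- Size of the message set of Transmitter 1. -/
  size₁ : ℕ
  /-- Size of the message set of Transmitter 2. -/
  size₂ : ℕ
  size₁_pos : 0 < size₁
  size₂_pos : 0 < size₂
  enc₁ : (t : Fin n) → Fin size₁ → ℝ
  enc₂ : (t : Fin n) → Fin size₂ → (Fin t → ℝ) → ℝ
  measurable_enc₂ : ∀ t m, Measurable (enc₂ t m)
  dec : (Fin n → ℝ) → Fin size₁ × Fin size₂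
  measurable_dec : Measurable dec

namespace PartialFeedbackCode

variable {n : ℕ} (c : PartialFeedbackCode n)

/-- Outcomes `((m₁, m₂), (z, w))`: the two messages, the receiver noise, the feedback noise. -/
abbrev Outcome : Type :=
  (Fin c.size₁ × Fin c.size₂) × ((Fin n → ℝ) × (Fin n → ℝ))

/-- Messages, receiver noise (variance `N`) and feedback noise (variance `σsq`) are
independent. -/
noncomputable def law (N σsq : ℝ≥0) : Measure c.Outcome :=
  (messageLaw c.size₁ c.size₂).prod ((noiseLaw n N).prod (noiseLaw n σsq))

/-- The channel output `Yₜ = X₁,ₜ + X₂,ₜ + Zₜ`, where `X₂,ₜ` is computed from the message of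
Transmitter 2 and the feedback outputs `Vᵢ = Yᵢ + Wᵢ`, `i < t`. -/
noncomputable def output (ω : c.Outcome) (t : Fin n) : ℝ :=
  c.enc₁ t ω.1.1
    + c.enc₂ t ω.1.2 (fun i : Fin t =>
        output ω ⟨i.val, i.isLt.trans t.isLt⟩ + ω.2.2 ⟨i.val, i.isLt.trans t.isLt⟩)
    + ω.2.1 t
termination_by t.val
decreasing_by exact i.isLt

/-- The feedback output `Vₜ = Yₜ + Wₜ`. -/
noncomputable def feedback (ω : c.Outcome) (t : Fin n) : ℝ :=
  c.output ω t + ω.2.2 t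

/-- The channel input `X₁,ₜ`. -/
def input₁ (t : Fin n) (ω : c.Outcome) : ℝ :=
  c.enc₁ t ω.1.1

/-- The channel input `X₂,ₜ`. -/
noncomputable def input₂ (t : Fin n) (ω : c.Outcome) : ℝ :=
  c.enc₂ t ω.1.2 (fun i : Fin t => c.feedback ω ⟨i.val, i.isLt.trans t.isLt⟩)

theorem output_eq (ω : c.Outcome) (t : Fin n) :
    c.output ω t = c.input₁ t ω + c.input₂ t ω + ω.2.1 t := by
  rw [output]; rfl

/-- The code respects the powers `P₁`, `P₂` on the channel with noise variances `N`, `σsq`. -/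
def Admissible (P₁ P₂ N σsq : ℝ≥0) : Prop :=
  PowerConstraint (c.law N σsq) c.input₁ P₁ ∧ PowerConstraint (c.law N σsq) c.input₂ P₂

/-- The average probability of a decoding error. -/
noncomputable def errorProb (N σsq : ℝ≥0) : ℝ≥0∞ :=
  c.law N σsq {ω | c.dec (c.output ω) ≠ ω.1}

/-- The rate (in nats per channel use) of Transmitter 1. -/
noncomputable def rate₁ : ℝ := 1 / n * Real.log c.size₁

/-- The rate (in nats per channel use) of Transmitter 2. -/
noncomputable def rate₂ : ℝ := 1 / n * Real.log c.size₂

end PartialFeedbackCode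

/-- The capacity region of the multiple-access channel with noisy partial feedback to
Transmitter 2: the set of all achievable rate pairs. -/
def capacityPartialFB (P₁ P₂ N σsq : ℝ≥0) : Set (ℝ × ℝ) :=
  {R | 0 ≤ R.1 ∧ 0 ≤ R.2 ∧ ∀ δ : ℝ, 0 < δ → ∃ c : (n : ℕ) → PartialFeedbackCode n,
    (∀ᶠ n in atTop, (c n).Admissible P₁ P₂ N σsq ∧
      R.1 - δ < (c n).rate₁ ∧ R.2 - δ < (c n).rate₂) ∧
    Tendsto (fun n => (c n).errorProb N σsq) atTop (𝓝 0)}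

/-! ### No feedback -/

/-- Encoders and decoder of blocklength `n` for the two-user multiple-access channel without
feedback: the inputs of each transmitter depend on its message only. -/
structure NoFeedbackCode (n : ℕ) where
  /-- Size of the message set of Transmitter 1. -/
  size₁ : ℕ
  /-- Size of the message set of Transmitter 2. -/
  size₂ : ℕ
  size₁_pos : 0 < size₁
  size₂_pos : 0 < size₂
  enc₁ : (t : Fin n) → Fin size₁ → ℝ
  enc₂ : (t : Fin n) → Fin size₂ → ℝ
  dec : (Fin n → ℝ) → Fin size₁ × Fin size₂
  measurable_dec : Measurable dec

namespace NoFeedbackCode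

variable {n : ℕ} (c : NoFeedbackCode n)

/-- Outcomes `((m₁, m₂), z)`: the two messages and the receiver noise. -/
abbrev Outcome : Type := (Fin c.size₁ × Fin c.size₂) × (Fin n → ℝ)

/-- Messages and receiver noise (variance `N`) are independent. -/
noncomputable def law (N : ℝ≥0) : Measure c.Outcome :=
  (messageLaw c.size₁ c.size₂).prod (noiseLaw n N)

/-- The channel input `X₁,ₜ`. -/
def input₁ (t : Fin n) (ω : c.Outcome) : ℝ := c.enc₁ t ω.1.1

/-- The channel input `X₂,ₜ`. -/
def input₂ (t : Fin n) (ω : c.Outcome) : ℝ := c.enc₂ t ω.1.2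

/-- The channel output `Yₜ = X₁,ₜ + X₂,ₜ + Zₜ`. -/
noncomputable def output (ω : c.Outcome) (t : Fin n) : ℝ :=
  c.input₁ t ω + c.input₂ t ω + ω.2 t

/-- The code respects the powers `P₁`, `P₂` on the channel with noise variance `N`. -/
def Admissible (P₁ P₂ N : ℝ≥0) : Prop :=
  PowerConstraint (c.law N) c.input₁ P₁ ∧ PowerConstraint (c.law N) c.input₂ P₂

/-- The average probability of a decoding error. -/
noncomputable def errorProb (N : ℝ≥0) : ℝ≥0∞ :=
  c.law N {ω | c.dec (c.output ω) ≠ ω.1}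

/-- The rate (in nats per channel use) of Transmitter 1. -/
noncomputable def rate₁ : ℝ := 1 / n * Real.log c.size₁

/-- The rate (in nats per channel use) of Transmitter 2. -/
noncomputable def rate₂ : ℝ := 1 / n * Real.log c.size₂

end NoFeedbackCode

/-- The capacity region of the classical multiple-access channel without feedback: the set of
all achievable rate pairs. -/
def capacityMAC (P₁ P₂ N : ℝ≥0) : Set (ℝ × ℝ) :=
  {R | 0 ≤ R.1 ∧ 0 ≤ R.2 ∧ ∀ δ : ℝ, 0 < δ → ∃ c : (n : ℕ) → NoFeedbackCode n,
    (∀ᶠ n in atTop, (c n).Admissible P₁ P₂ N ∧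
      R.1 - δ < (c n).rate₁ ∧ R.2 - δ < (c n).rate₂) ∧
    Tendsto (fun n => (c n).errorProb N) atTop (𝓝 0)}

end GaussianMAC

/-!
A code without feedback is a code that ignores its feedback, so feedback does not hurt.

Converse without feedback: compare the law of the output given the messages with the product of the
Gaussian laws that have the means of the outputs and the variance `P₁ + P₂ + N`. Under the product
law the messages are guessed correctly with probability `1 / (|M₁| |M₂|)`, while the mean
log-likelihood ratio is at least `-(n / 2) log (1 + (P₁ + P₂) / N)`, because the power constraints
bound the sum of the variances of the inputs. By Jensen's inequality `R₁ + R₂` cannot exceed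
`(1 / 2) log (1 + (P₁ + P₂) / N)`.

With feedback this bound is beaten by a linear scheme over two channel uses. In the second use
Transmitter 2 adds a multiple `κ` of what it heard in the first use, and with it a part of the
first symbol of Transmitter 1, which Transmitter 1 also repeats with a weight `α`. Subtracting a
multiple of its own first symbol, Transmitter 2 makes the two outputs uncorrelated. The inputs of
the second use are then correlated, and its output gains the variance `2 α κ Q₁`, whereas the
feedback noise costs only an amount of order `κ ^ 2`. With `α = ε` and `κ = c ε` the gain exceeds
the cost for small `c`. Random coding over the memoryless channel formed by the pairs of uses turns
the resulting mutual information into an achievable sum rate.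
-/

namespace GaussianMAC

/-! ### Gaussian densities and quadratic forms -/

/-- The logarithm of the density of the centred Gaussian law of variance `v`. -/
noncomputable def logDensity (v x : ℝ) : ℝ :=
  -(1 / 2) * Real.log (2 * Real.pi * v) - x ^ 2 / (2 * v)

theorem measurable_logDensity (v : ℝ) : Measurable (logDensity v) := by
  unfold logDensity; fun_prop

theorem exp_logDensity {v : ℝ≥0} (hv : 0 < v) (m x : ℝ) :
    Real.exp (logDensity v (x - m)) = gaussianPDFReal m v x := by
  have h : 0 < 2 * Real.pi * (v : ℝ) := by positivity
  rw [gaussianPDFReal, logDensity, sub_eq_add_neg, Real.exp_add, Real.sqrt_eq_rpow,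
    Real.rpow_def_of_pos h, ← Real.exp_neg]
  congr 2
  · ring
  · ring

theorem lintegral_gaussianReal {v : ℝ≥0} (hv : 0 < v) (m : ℝ) {f : ℝ → ℝ≥0∞} (hf : Measurable f) :
    ∫⁻ x, f x ∂gaussianReal m v
      = ∫⁻ x, ENNReal.ofReal (Real.exp (logDensity v (x - m))) * f x := by
  rw [gaussianReal_of_var_ne_zero _ hv.ne',
    lintegral_withDensity_eq_lintegral_mul _ (measurable_gaussianPDF m v) hf]
  simp only [Pi.mul_apply, gaussianPDF, exp_logDensity hv]

/-- Likelihood times prior is marginal times posterior, for the observation `y = c x + z`. -/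
theorem logDensity_bayes {V P : ℝ} (hV : 0 < V) (hP : 0 < P) (c m x y : ℝ) :
    logDensity V (y - c * x) + logDensity P (x - m)
      = logDensity (V + c ^ 2 * P) (y - c * m)
        + logDensity (P * V / (V + c ^ 2 * P))
          (x - (m + c * P * (y - c * m) / (V + c ^ 2 * P))) := by
  have hlog : Real.log (2 * Real.pi * V) + Real.log (2 * Real.pi * P)
      = Real.log (2 * Real.pi * (V + c ^ 2 * P))
        + Real.log (2 * Real.pi * (P * V / (V + c ^ 2 * P))) := by
    rw [← Real.log_mul (by positivity) (by positivity),
      ← Real.log_mul (by positivity) (by positivity)]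
    congr 1
    field_simp
  have hquad : (y - c * x) ^ 2 / (2 * V) + (x - m) ^ 2 / (2 * P)
      = (y - c * m) ^ 2 / (2 * (V + c ^ 2 * P))
        + (x - (m + c * P * (y - c * m) / (V + c ^ 2 * P))) ^ 2
          / (2 * (P * V / (V + c ^ 2 * P))) := by
    field_simp
    ring
  unfold logDensity
  linarith

theorem lintegral_gaussianReal_bayes {V : ℝ} {P : ℝ≥0} (hV : 0 < V) (hP : 0 < P) (c m y : ℝ)
    {f : ℝ → ℝ≥0∞} (hf : Measurable f) :
    ∫⁻ x, ENNReal.ofReal (Real.exp (logDensity V (y - c * x))) * f x ∂gaussianReal m P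
      = ENNReal.ofReal (Real.exp (logDensity (V + c ^ 2 * P) (y - c * m))) *
        ∫⁻ x, f x ∂gaussianReal (m + c * P * (y - c * m) / (V + c ^ 2 * P))
          (P * V / (V + c ^ 2 * P)).toNNReal := by
  have hP' : (0 : ℝ) < P := hP
  have hpost : 0 < (P * V / (V + c ^ 2 * P)).toNNReal := Real.toNNReal_pos.2 (by positivity)
  have hm := measurable_logDensity
  rw [lintegral_gaussianReal hP m (by fun_prop), lintegral_gaussianReal hpost _ hf,
    ← lintegral_const_mul _ (by fun_prop)]
  refine lintegral_congr fun x => ?_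
  rw [← mul_assoc, ← mul_assoc, ← ENNReal.ofReal_mul (Real.exp_nonneg _),
    ← ENNReal.ofReal_mul (Real.exp_nonneg _), ← Real.exp_add, ← Real.exp_add,
    add_comm (logDensity P _), logDensity_bayes hV hP' c m x y,
    Real.coe_toNNReal _ (by positivity)]

theorem lintegral_gaussianReal_conv {V : ℝ} {P : ℝ≥0} (hV : 0 < V) (hP : 0 < P) (c m y K : ℝ) :
    ∫⁻ x, ENNReal.ofReal (Real.exp (K + logDensity V (y - c * x))) ∂gaussianReal m P
      = ENNReal.ofReal (Real.exp (K + logDensity (V + c ^ 2 * P) (y - c * m))) := by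
  have h := lintegral_gaussianReal_bayes hV hP c m y (f := fun _ => ENNReal.ofReal (Real.exp K))
    measurable_const
  simp only [lintegral_const, measure_univ, mul_one, ← ENNReal.ofReal_mul (Real.exp_nonneg _),
    ← Real.exp_add] at h
  simpa only [add_comm K] using h

theorem lintegral_gaussianReal_conv₂ {V W : ℝ} {P : ℝ≥0} (hV : 0 < V) (hW : 0 < W) (hP : 0 < P)
    (c d y z K : ℝ) :
    ∫⁻ x, ENNReal.ofReal (Real.exp (K + logDensity V (y - c * x) + logDensity W (z - d * x)))
        ∂gaussianReal 0 P
      = ENNReal.ofReal (Real.exp (K + logDensity (V + c ^ 2 * P) y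
        + logDensity (W + d ^ 2 * (P * V / (V + c ^ 2 * P)))
            (z - d * (c * P * y / (V + c ^ 2 * P))))) := by
  have hpost : 0 < (P * V / (V + c ^ 2 * P)).toNNReal := Real.toNNReal_pos.2 (by positivity)
  have hm := measurable_logDensity
  have h := lintegral_gaussianReal_bayes hV hP c 0 y
    (f := fun x => ENNReal.ofReal (Real.exp (K + logDensity W (z - d * x)))) (by fun_prop)
  rw [lintegral_gaussianReal_conv hW hpost] at h
  simp only [← ENNReal.ofReal_mul (Real.exp_nonneg _), ← Real.exp_add, mul_zero, sub_zero,
    zero_add] at h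
  rw [Real.coe_toNNReal _ (by positivity)] at h
  simp only [add_assoc, add_left_comm K]
  exact h

section SymbolPair

variable {V : ℝ} {Q : ℝ≥0} (hV : 0 < V) (hQ : 0 < Q)
include hV hQ

theorem lintegral_gaussianReal_prod_conv {F u : ℝ → ℝ} (hF : Measurable F) (hu : Measurable u)
    (c : ℝ) :
    ∫⁻ x, ENNReal.ofReal (Real.exp (F x.1 + logDensity V (u x.1 - c * x.2)))
        ∂(gaussianReal 0 Q).prod (gaussianReal 0 Q)
      = ∫⁻ x, ENNReal.ofReal (Real.exp (F x + logDensity (V + c ^ 2 * Q) (u x)))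
          ∂gaussianReal 0 Q := by
  have hm := measurable_logDensity
  rw [lintegral_prod _ (by fun_prop)]
  simp only [lintegral_gaussianReal_conv hV hQ, mul_zero, sub_zero]

theorem lintegral_gaussianReal_prod_conv_sub {W : ℝ} (hW : 0 < W) {u : ℝ → ℝ} (hu : Measurable u)
    (c y K : ℝ) :
    ∫⁻ x, ENNReal.ofReal (Real.exp (K + logDensity W (y - x.1)
        + (logDensity V (u x.1 - c * x.2) - logDensity (V + c ^ 2 * Q) (u x.1))))
        ∂(gaussianReal 0 Q).prod (gaussianReal 0 Q)
      = ENNReal.ofReal (Real.exp (K + logDensity (W + Q) y)) := by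
  have hm := measurable_logDensity
  have h := lintegral_gaussianReal_prod_conv hV hQ (u := u) (F := fun x => K + logDensity W (y - x)
    - logDensity (V + c ^ 2 * Q) (u x)) (by fun_prop) hu c
  have h' := lintegral_gaussianReal_conv hW hQ 1 0 y K
  simp only [one_mul, one_pow, sub_zero, mul_zero] at h'
  simp only [sub_add_cancel, h'] at h
  rw [← h]
  refine lintegral_congr fun x => ?_
  congr 2
  ring

theorem lintegral_gaussianReal_prod_conv₂ {W : ℝ} (hW : 0 < W) (c d y z K : ℝ) :
    ∫⁻ x, ENNReal.ofReal (Real.exp (K + logDensity W (y - x.1)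
        + logDensity V (z - d * x.1 - c * x.2))) ∂(gaussianReal 0 Q).prod (gaussianReal 0 Q)
      = ENNReal.ofReal (Real.exp (K + logDensity (W + Q) y
        + logDensity (V + c ^ 2 * Q + d ^ 2 * (Q * W / (W + Q))) (z - d * (Q * y / (W + Q))))) := by
  have hm := measurable_logDensity
  have h := lintegral_gaussianReal_conv₂ hW (W := V + c ^ 2 * Q) (by positivity) hQ 1 d y z K
  simp only [one_mul, one_pow] at h
  rw [lintegral_gaussianReal_prod_conv hV hQ (F := fun x => K + logDensity W (y - x))
    (u := fun x => z - d * x) (by fun_prop) (by fun_prop), h]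

end SymbolPair

/-- A square-integrable centred random variable `f` of variance `v`. -/
structure Centered {X : Type*} [MeasurableSpace X] (ρ : Measure X) (f : X → ℝ) (v : ℝ) :
    Prop where
  memLp : MemLp f 2 ρ
  mean : ∫ x, f x ∂ρ = 0
  second : ∫ x, f x ^ 2 ∂ρ = v

namespace Centered

variable {X X' : Type*} [MeasurableSpace X] [MeasurableSpace X'] {ρ : Measure X} {ρ' : Measure X'}
  {f : X → ℝ} {g : X' → ℝ} {v w : ℝ}

theorem integrable_sq (h : Centered ρ f v) : Integrable (fun x => f x ^ 2) ρ :=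
  h.memLp.integrable_sq

theorem integrable [IsFiniteMeasure ρ] (h : Centered ρ f v) : Integrable f ρ :=
  h.memLp.integrable (by norm_num)

theorem gaussianReal (v : ℝ≥0) : Centered (gaussianReal 0 v) (fun x => x) v where
  memLp := memLp_id_gaussianReal 2
  mean := integral_id_gaussianReal
  second := by
    have h := variance_fun_id_gaussianReal (μ := 0) (v := v)
    rwa [variance_of_integral_eq_zero (by fun_prop) integral_id_gaussianReal] at h

theorem congr {f' : X → ℝ} (h : Centered ρ f v) (hf : ∀ x, f x = f' x) {v' : ℝ} (hv : v = v') :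
    Centered ρ f' v' := by
  rwa [← show f = f' from funext hf, ← hv]

theorem const_mul (h : Centered ρ f v) (c : ℝ) : Centered ρ (fun x => c * f x) (c ^ 2 * v) where
  memLp := h.memLp.const_mul c
  mean := by rw [integral_const_mul, h.mean, mul_zero]
  second := by simp only [mul_pow]; rw [integral_const_mul, h.second]

theorem prod [IsProbabilityMeasure ρ] [IsProbabilityMeasure ρ'] (hf : Centered ρ f v)
    (hg : Centered ρ' g w) : Centered (ρ.prod ρ') (fun p => f p.1 + g p.2) (v + w) where
  memLp := (hf.memLp.comp_fst ρ').add (hg.memLp.comp_snd ρ)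
  mean := by
    rw [integral_add ((hf.integrable).comp_fst ρ') ((hg.integrable).comp_snd ρ),
      integral_fun_fst, integral_fun_snd, hf.mean, hg.mean]
    simp
  second := by
    have e : ∀ p : X × X', (f p.1 + g p.2) ^ 2
        = f p.1 ^ 2 + g p.2 ^ 2 + 2 * (f p.1 * g p.2) := fun p => by ring
    have i1 : Integrable (fun p : X × X' => f p.1 ^ 2) (ρ.prod ρ') :=
      hf.integrable_sq.comp_fst ρ'
    have i2 : Integrable (fun p : X × X' => g p.2 ^ 2) (ρ.prod ρ') :=
      hg.integrable_sq.comp_snd ρ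
    have i3 : Integrable (fun p : X × X' => 2 * (f p.1 * g p.2)) (ρ.prod ρ') :=
      (hf.integrable.mul_prod hg.integrable).const_mul 2
    simp only [e]
    rw [integral_add (f := fun p : X × X' => f p.1 ^ 2 + g p.2 ^ 2) (i1.add i2) i3,
      integral_add i1 i2, integral_fun_fst (fun x => f x ^ 2),
      integral_fun_snd (fun x => g x ^ 2), integral_const_mul, integral_prod_mul, hf.mean,
      hf.second, hg.second]
    simp

theorem integrable_logDensity [IsFiniteMeasure ρ] (h : Centered ρ f v) (V : ℝ) :
    Integrable (fun x => logDensity V (f x)) ρ :=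
  (integrable_const _).sub (h.integrable_sq.div_const _)

theorem integral_logDensity [IsProbabilityMeasure ρ] (h : Centered ρ f v) (V : ℝ) :
    ∫ x, logDensity V (f x) ∂ρ = -(1 / 2) * Real.log (2 * Real.pi * V) - v / (2 * V) := by
  unfold logDensity
  rw [integral_sub (integrable_const _) (h.integrable_sq.div_const _), integral_div, h.second]
  simp

end Centered

/-! ### Products of probability measures -/

section Products

variable {X : Type*} [MeasurableSpace X] {ι : Type*} [Fintype ι]

theorem map_pi_precomp {κ : Type*} [Fintype κ] (ρ : Measure X) [IsProbabilityMeasure ρ]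
    {s : ι → κ} (hs : Function.Injective s) :
    (Measure.pi fun _ : κ => ρ).map (fun x i => x (s i)) = Measure.pi fun _ : ι => ρ := by
  have h := Measure.map_infinitePi_infinitePi_of_inj (P := fun _ : κ => ρ) hs
  simpa only [Measure.infinitePi_eq_pi] using h

theorem lintegral_pi_prod_eq (ρ : ι → Measure X) [∀ i, IsProbabilityMeasure (ρ i)]
    {f : ι → X → ℝ≥0∞} (hf : ∀ i, Measurable (f i)) :
    ∫⁻ x, ∏ i, f i (x i) ∂Measure.pi ρ = ∏ i, ∫⁻ x, f i x ∂ρ i := by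
  have h := lintegral_prod_eq_prod_lintegral_of_indepFun Finset.univ
    (fun i (x : ι → X) => f i (x i)) (iIndepFun_pi (μ := ρ) fun i => (hf i).aemeasurable)
    (fun i => (hf i).comp (measurable_pi_apply i))
  rw [h]
  refine Finset.prod_congr rfl fun i _ => ?_
  rw [← (measurePreserving_eval ρ i).map_eq, lintegral_map (hf i) (measurable_pi_apply i)]

/-- The distance from the empirical average of `g` over a block to the mean of `g` under `ρ`. -/
noncomputable def averageDev (ρ : Measure X) (g : X → ℝ) {k : ℕ} (x : Fin k → X) : ℝ≥0∞ :=
  ‖(k : ℝ)⁻¹ * ∑ t, g (x t) - ∫ y, g y ∂ρ‖ₑ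

theorem measurable_averageDev (ρ : Measure X) {g : X → ℝ} (hg : Measurable g) (k : ℕ) :
    Measurable (averageDev ρ g (k := k)) := by
  unfold averageDev; fun_prop

theorem one_le_mul_averageDev {ρ : Measure X} {g : X → ℝ} {τ : ℝ} (hτ : τ < ∫ y, g y ∂ρ) {k : ℕ}
    (hk : 0 < k) {x : Fin k → X} (hx : ∑ t, g (x t) < k * τ) :
    1 ≤ ENNReal.ofReal ((∫ y, g y ∂ρ - τ)⁻¹) * averageDev ρ g x := by
  have hpos := sub_pos.2 hτ
  have hle : (k : ℝ)⁻¹ * ∑ t, g (x t) ≤ τ := by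
    rw [inv_mul_le_iff₀ (Nat.cast_pos.2 hk)]
    exact hx.le
  rw [averageDev, Real.enorm_eq_ofReal_abs, ← ENNReal.ofReal_mul (by positivity),
    ENNReal.one_le_ofReal, inv_mul_eq_div, one_le_div hpos, abs_sub_comm]
  exact (sub_le_sub_left hle _).trans (le_abs_self _)

theorem ofReal_sum_le_mul_averageDev (ρ : Measure X) (g : X → ℝ) {k : ℕ} (x : Fin k → X) :
    ENNReal.ofReal (∑ t, g (x t))
      ≤ k * (ENNReal.ofReal (∫ y, g y ∂ρ) + averageDev ρ g x) := by
  rcases k.eq_zero_or_pos with rfl | hk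
  · simp
  have hk' : (0 : ℝ) < k := Nat.cast_pos.2 hk
  have hsum : ∑ t, g (x t)
      ≤ k * (∫ y, g y ∂ρ + |(k : ℝ)⁻¹ * ∑ t, g (x t) - ∫ y, g y ∂ρ|) := by
    rw [← inv_mul_le_iff₀ hk', ← sub_le_iff_le_add']
    exact le_abs_self _
  rw [averageDev, Real.enorm_eq_ofReal_abs, ← ENNReal.ofReal_natCast]
  refine (ENNReal.ofReal_le_ofReal hsum).trans ?_
  rw [ENNReal.ofReal_mul hk'.le]
  gcongr
  exact ENNReal.ofReal_add_le

theorem lintegral_ofReal_sum_le {Ω : Type*} [MeasurableSpace Ω] {P : Measure Ω}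
    [IsProbabilityMeasure P] {ρ : Measure X} {g : X → ℝ} {K : ℝ} (h0 : 0 ≤ ∫ y, g y ∂ρ)
    (hK : ∫ y, g y ∂ρ ≤ K) {k : ℕ} {x : Ω → Fin k → X}
    (h : ∫⁻ ω, averageDev ρ g (x ω) ∂P ≤ ENNReal.ofReal (K - ∫ y, g y ∂ρ)) :
    ∫⁻ ω, ENNReal.ofReal (∑ t, g (x ω t)) ∂P ≤ k * ENNReal.ofReal K :=
  calc ∫⁻ ω, ENNReal.ofReal (∑ t, g (x ω t)) ∂P
      ≤ ∫⁻ ω, k * (ENNReal.ofReal (∫ y, g y ∂ρ) + averageDev ρ g (x ω)) ∂P :=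
        lintegral_mono fun ω => ofReal_sum_le_mul_averageDev ρ g (x ω)
    _ = k * (ENNReal.ofReal (∫ y, g y ∂ρ) + ∫⁻ ω, averageDev ρ g (x ω) ∂P) := by
        rw [lintegral_const_mul' _ _ (ENNReal.natCast_ne_top k),
          lintegral_add_left measurable_const, lintegral_const, measure_univ, mul_one]
    _ ≤ k * (ENNReal.ofReal (∫ y, g y ∂ρ) + ENNReal.ofReal (K - ∫ y, g y ∂ρ)) := by gcongr
    _ = k * ENNReal.ofReal K := by
        rw [← ENNReal.ofReal_add h0 (sub_nonneg.2 hK), add_sub_cancel]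

theorem tendsto_lintegral_averageDev (ρ : Measure X) [IsProbabilityMeasure ρ] {g : X → ℝ}
    (hg : Measurable g) (hi : Integrable g ρ) :
    Tendsto (fun k : ℕ => ∫⁻ x, averageDev ρ g x ∂(Measure.pi fun _ : Fin k => ρ)) atTop
      (𝓝 0) := by
  set Q := Measure.infinitePi fun _ : ℕ => ρ
  have hmp : ∀ i : ℕ, MeasurePreserving (Function.eval i) Q ρ := fun i =>
    measurePreserving_eval_infinitePi _ i
  have h0 : ∫ x, g (x 0) ∂Q = ∫ y, g y ∂ρ := by
    rw [← (hmp 0).map_eq, integral_map (hmp 0).aemeasurable hg.aestronglyMeasurable]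
  have h := strong_law_Lp (μ := Q) (p := 1) le_rfl (by simp) (fun i (x : ℕ → X) => g (x i))
    (memLp_one_iff_integrable.2 ((hmp 0).integrable_comp_of_integrable hi))
    (fun i j hij => (iIndepFun_infinitePi (P := fun _ : ℕ => ρ) (X := fun _ => g)
      fun _ => hg).indepFun hij)
    (fun i => by
      refine ⟨(hg.comp (hmp i).measurable).aemeasurable,
        (hg.comp (hmp 0).measurable).aemeasurable, ?_⟩
      change Q.map (g ∘ Function.eval i) = Q.map (g ∘ Function.eval 0)
      rw [← Measure.map_map hg (hmp i).measurable, ← Measure.map_map hg (hmp 0).measurable,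
        (hmp i).map_eq, (hmp 0).map_eq])
  refine h.congr fun k => ?_
  rw [eLpNorm_one_eq_lintegral_enorm, h0]
  have hk := Measure.map_infinitePi_infinitePi_of_inj (P := fun _ : ℕ => ρ)
    (Fin.val_injective (n := k))
  rw [Measure.infinitePi_eq_pi (ι := Fin k)] at hk
  rw [← hk, lintegral_map (measurable_averageDev ρ hg k) (by fun_prop)]
  refine lintegral_congr fun x => ?_
  rw [averageDev, Finset.sum_range (fun i => g (x i)), smul_eq_mul]

theorem tendsto_measure_pi_sum_lt (ρ : Measure X) [IsProbabilityMeasure ρ] {g : X → ℝ}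
    (hg : Measurable g) (hi : Integrable g ρ) {τ : ℝ} (hτ : τ < ∫ y, g y ∂ρ) :
    Tendsto (fun k : ℕ => (Measure.pi fun _ : Fin k => ρ) {x | ∑ t, g (x t) < k * τ}) atTop
      (𝓝 0) := by
  have h := ENNReal.Tendsto.const_mul (a := ENNReal.ofReal ((∫ y, g y ∂ρ - τ)⁻¹))
    (tendsto_lintegral_averageDev ρ hg hi) (Or.inr ENNReal.ofReal_ne_top)
  rw [mul_zero] at h
  refine tendsto_of_tendsto_of_tendsto_of_le_of_le' tendsto_const_nhds h
    (Eventually.of_forall fun _ => zero_le) ((eventually_gt_atTop 0).mono fun k hk => ?_)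
  have hS : MeasurableSet {x : Fin k → X | ∑ t, g (x t) < k * τ} :=
    measurableSet_lt (by fun_prop) measurable_const
  rw [← lintegral_const_mul _ (measurable_averageDev ρ hg k), ← lintegral_indicator_one hS]
  exact lintegral_mono (Set.indicator_le fun x hx => one_le_mul_averageDev hτ hk hx)

theorem measure_pi_le_sum_le_exp_neg (ρ : Measure X) [IsProbabilityMeasure ρ]
    {k : ℕ} {h : Fin k → X → ℝ} (hm : ∀ t, Measurable (h t))
    (h1 : ∀ t, ∫⁻ x, ENNReal.ofReal (Real.exp (h t x)) ∂ρ ≤ 1) (τ : ℝ) :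
    (Measure.pi fun _ : Fin k => ρ) {x | τ ≤ ∑ t, h t (x t)}
      ≤ ENNReal.ofReal (Real.exp (-τ)) := by
  have hpos : ENNReal.ofReal (Real.exp τ) ≠ 0 := by simp [Real.exp_pos]
  have hle : ∫⁻ x, ∏ t, ENNReal.ofReal (Real.exp (h t (x t))) ∂(Measure.pi fun _ : Fin k => ρ)
      ≤ 1 := by
    rw [lintegral_pi_prod_eq (fun _ => ρ) fun t => (hm t).exp.ennreal_ofReal]
    exact Finset.prod_le_one' fun t _ => h1 t
  have hmarkov := mul_meas_ge_le_lintegral (μ := Measure.pi fun _ : Fin k => ρ)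
    (f := fun x => ∏ t, ENNReal.ofReal (Real.exp (h t (x t)))) (by fun_prop)
    (ENNReal.ofReal (Real.exp τ))
  rw [Real.exp_neg, ENNReal.ofReal_inv_of_pos (Real.exp_pos _), ← one_div,
    ENNReal.le_div_iff_mul_le (Or.inl hpos) (Or.inl ENNReal.ofReal_ne_top), mul_comm]
  refine le_trans (mul_le_mul_right (measure_mono fun x hx => ?_) _) (hmarkov.trans hle)
  change _ ≤ ∏ t, ENNReal.ofReal (Real.exp (h t (x t)))
  rw [← ENNReal.ofReal_prod_of_nonneg fun _ _ => Real.exp_nonneg _, ← Real.exp_sum]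
  exact ENNReal.ofReal_le_ofReal (Real.exp_le_exp.2 hx)

end Products

section Zip

variable {A B E : Type*} [MeasurableSpace A] [MeasurableSpace B] [MeasurableSpace E]

theorem measurePreserving_zip (μ : Measure A) [IsProbabilityMeasure μ] (ν : Measure B)
    [IsProbabilityMeasure ν] (ι : Type*) [Fintype ι] :
    MeasurePreserving (fun (x : (ι → A) × (ι → B)) t => (x.1 t, x.2 t))
      ((Measure.pi fun _ => μ).prod (Measure.pi fun _ => ν))
      (Measure.pi fun _ => μ.prod ν) :=
  (measurePreserving_arrowProdEquivProdArrow A B ι (fun _ => μ) (fun _ => ν)).symm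

theorem measurePreserving_zip₃ (μ : Measure A) [IsProbabilityMeasure μ] (ν : Measure B)
    [IsProbabilityMeasure ν] (η : Measure E) [IsProbabilityMeasure η] (ι : Type*) [Fintype ι] :
    MeasurePreserving (fun (x : (ι → A) × ((ι → B) × (ι → E))) t => (x.1 t, x.2.1 t, x.2.2 t))
      ((Measure.pi fun _ => μ).prod ((Measure.pi fun _ => ν).prod (Measure.pi fun _ => η)))
      (Measure.pi fun _ => μ.prod (ν.prod η)) :=
  (measurePreserving_zip μ (ν.prod η) ι).comp
    ((MeasurePreserving.id _).prod (measurePreserving_zip ν η ι))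

theorem measure_prod_pi_le_sum_le_exp_neg (μ : Measure A) [IsProbabilityMeasure μ] (ν : Measure B)
    [IsProbabilityMeasure ν] {k : ℕ} {h : Fin k → A × B → ℝ} (hm : ∀ t, Measurable (h t))
    (h1 : ∀ t, ∫⁻ x, ENNReal.ofReal (Real.exp (h t x)) ∂(μ.prod ν) ≤ 1) (τ : ℝ) :
    ((Measure.pi fun _ : Fin k => μ).prod (Measure.pi fun _ : Fin k => ν))
        {x | τ ≤ ∑ t, h t (x.1 t, x.2 t)}
      ≤ ENNReal.ofReal (Real.exp (-τ)) := by
  refine le_trans (le_of_eq ?_) (measure_pi_le_sum_le_exp_neg (μ.prod ν) hm h1 τ)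
  exact (measurePreserving_zip μ ν (Fin k)).measure_preimage
    (s := {x | τ ≤ ∑ t, h t (x t)})
    (measurableSet_le measurable_const (by fun_prop)).nullMeasurableSet

end Zip

/-! ### Random coding for two transmitters -/

theorem measurePreserving_eval_pair {X ι : Type*} [MeasurableSpace X] [Fintype ι] (μ : Measure X)
    [IsProbabilityMeasure μ] {i j : ι} (hij : i ≠ j) :
    MeasurePreserving (fun x : ι → X => (x i, x j)) (Measure.pi fun _ => μ) (μ.prod μ) := by
  refine ⟨by fun_prop, ?_⟩
  rw [← Measure.infinitePi_eq_pi]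
  exact Measure.infinitePi_map_eval_prod (P := fun _ : ι => μ) hij

section Independence

variable {A B E : Type*} [MeasurableSpace A] [MeasurableSpace B] [MeasurableSpace E]
  (μ : Measure A) (ν : Measure B) (η : Measure E)

theorem measurePreserving_prodLeftComm [SFinite μ] [SFinite ν] [SFinite η] :
    MeasurePreserving (fun q : A × (B × E) => (q.2.1, (q.1, q.2.2))) (μ.prod (ν.prod η))
      (ν.prod (μ.prod η)) :=
  (measurePreserving_prodAssoc ν μ η).comp
    ((Measure.measurePreserving_swap.prod (MeasurePreserving.id η)).comp
      (measurePreserving_prodAssoc μ ν η).symm)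

theorem measure_preimage_le_of_forall_slice_le {Ω : Type*} [MeasurableSpace Ω] {P : Measure Ω}
    [SFinite μ] [IsProbabilityMeasure ν] {g : Ω → A × B} (hg : MeasurePreserving g P (μ.prod ν))
    {S : Set (A × B)} (hS : MeasurableSet S) {t : ℝ≥0∞} (h : ∀ y, μ {x | (x, y) ∈ S} ≤ t) :
    P (g ⁻¹' S) ≤ t := by
  rw [hg.measure_preimage hS.nullMeasurableSet, Measure.prod_apply_symm hS]
  exact (lintegral_mono h).trans (by simp)

variable [IsProbabilityMeasure μ] [IsProbabilityMeasure ν] [IsProbabilityMeasure η]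
  {ι κ : Type*} [Fintype ι] [Fintype κ]

theorem measurePreserving_codeword (i : ι) (j : κ) :
    MeasurePreserving (fun q : ((ι → A) × (κ → B)) × E => (q.1.1 i, (q.1.2 j, q.2)))
      (((Measure.pi fun _ => μ).prod (Measure.pi fun _ => ν)).prod η) (μ.prod (ν.prod η)) :=
  (measurePreserving_prodAssoc μ ν η).comp
    (((measurePreserving_eval (fun _ => μ) i).prod
      (measurePreserving_eval (fun _ => ν) j)).prod (MeasurePreserving.id η))

theorem measurePreserving_fresh_codeword₁ {i i' : ι} (hi : i' ≠ i) (j : κ) :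
    MeasurePreserving (fun q : ((ι → A) × (κ → B)) × E => (q.1.1 i', (q.1.1 i, (q.1.2 j, q.2))))
      (((Measure.pi fun _ => μ).prod (Measure.pi fun _ => ν)).prod η)
      (μ.prod (μ.prod (ν.prod η))) :=
  ((measurePreserving_prodAssoc μ μ (ν.prod η)).comp
    (measurePreserving_prodAssoc (μ.prod μ) ν η)).comp
    (((measurePreserving_eval_pair μ hi).prod
      (measurePreserving_eval (fun _ => ν) j)).prod (MeasurePreserving.id η))

theorem measurePreserving_fresh_codeword₂ (i : ι) {j j' : κ} (hj : j' ≠ j) :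
    MeasurePreserving (fun q : ((ι → A) × (κ → B)) × E => (q.1.2 j', (q.1.1 i, (q.1.2 j, q.2))))
      (((Measure.pi fun _ => μ).prod (Measure.pi fun _ => ν)).prod η)
      (ν.prod (μ.prod (ν.prod η))) :=
  ((measurePreserving_prodLeftComm μ ν (ν.prod η)).comp
    (((MeasurePreserving.id μ).prod (measurePreserving_prodAssoc ν ν η)).comp
      (measurePreserving_prodAssoc μ (ν.prod ν) η))).comp
    (((measurePreserving_eval (fun _ => μ) i).prod
      (measurePreserving_eval_pair ν hj)).prod (MeasurePreserving.id η))

theorem measurePreserving_fresh_codewords {i i' : ι} (hi : i' ≠ i) {j j' : κ} (hj : j' ≠ j) :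
    MeasurePreserving (fun q : ((ι → A) × (κ → B)) × E =>
        ((q.1.1 i', q.1.2 j'), (q.1.1 i, (q.1.2 j, q.2))))
      (((Measure.pi fun _ => μ).prod (Measure.pi fun _ => ν)).prod η)
      ((μ.prod ν).prod (μ.prod (ν.prod η))) :=
  ((measurePreserving_prodAssoc μ ν (μ.prod (ν.prod η))).symm.comp
    (((MeasurePreserving.id μ).prod (measurePreserving_prodLeftComm μ ν (ν.prod η))).comp
      (((MeasurePreserving.id μ).prod
        ((MeasurePreserving.id μ).prod (measurePreserving_prodAssoc ν ν η))).comp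
      ((measurePreserving_prodAssoc μ μ ((ν.prod ν).prod η)).comp
        (measurePreserving_prodAssoc (μ.prod μ) (ν.prod ν) η))))).comp
    (((measurePreserving_eval_pair μ hi).prod
      (measurePreserving_eval_pair ν hj)).prod (MeasurePreserving.id η))

end Independence

theorem exists_measurable_selection {ι Y : Type*} [Finite ι] [Nonempty ι] [MeasurableSpace ι]
    [MeasurableSpace Y] (D : ι → Set Y) (hD : ∀ i, MeasurableSet (D i)) :
    ∃ dec : Y → ι, Measurable dec ∧ ∀ y i, y ∈ D i → (∀ j, y ∈ D j → j = i) → dec y = i := by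
  classical
  let φ : Y → ι → Prop := fun y i => y ∈ D i
  let ψ : (ι → Prop) → ι := fun s => if h : ∃ i, s i then h.choose else Classical.arbitrary ι
  have hφ : Measurable φ := measurable_pi_lambda _ fun i => measurableSet_setOfPred.1 (hD i)
  refine ⟨ψ ∘ φ, (measurable_of_finite ψ).comp hφ, fun y i hi hu => ?_⟩
  have hex : ∃ i, φ y i := ⟨i, hi⟩
  have hψ : ψ (φ y) = hex.choose := dif_pos hex
  exact hψ.trans (hu _ hex.choose_spec)

section RandomChoice

variable {C M E Y : Type*} [MeasurableSpace C] [MeasurableSpace M] [MeasurableSpace E]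
  [MeasurableSpace Y] [MeasurableSingletonClass M] {γ : Measure C} [IsProbabilityMeasure γ]
  {π : Measure M} [IsProbabilityMeasure π] {η : Measure E} [SFinite η] {θ : ℝ≥0∞}

theorem exists_lintegral_le_of_forall_lintegral_le [Countable M] {Φ : C → M → E → ℝ≥0∞}
    (hΦ : ∀ m, Measurable fun q : C × E => Φ q.1 m q.2)
    (h : ∀ m, ∫⁻ q, Φ q.1 m q.2 ∂γ.prod η ≤ θ) :
    ∃ c, ∫⁻ ω, Φ c ω.1 ω.2 ∂π.prod η ≤ θ := by
  have hΦ' : Measurable fun q : C × (M × E) => Φ q.1 q.2.1 q.2.2 :=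
    (measurable_from_prod_countable_right (f := fun q : M × (C × E) => Φ q.2.1 q.1 q.2.2) hΦ).comp
      (g := fun q : M × (C × E) => Φ q.2.1 q.1 q.2.2)
      (f := fun q : C × (M × E) => (q.2.1, (q.1, q.2.2))) (by fun_prop)
  obtain ⟨c, hc⟩ := exists_le_lintegral (μ := γ)
    (f := fun c => ∫⁻ ω, Φ c ω.1 ω.2 ∂π.prod η)
    (hΦ'.lintegral_prod_right' (ν := π.prod η)).aemeasurable
  refine ⟨c, hc.trans ?_⟩
  calc ∫⁻ c, ∫⁻ ω, Φ c ω.1 ω.2 ∂π.prod η ∂γ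
      = ∫⁻ m, ∫⁻ e, ∫⁻ c, Φ c m e ∂γ ∂η ∂π := by
        rw [lintegral_lintegral_swap hΦ'.aemeasurable,
          lintegral_prod _ (hΦ'.lintegral_prod_left' (μ := γ)).aemeasurable]
    _ = ∫⁻ m, ∫⁻ q, Φ q.1 m q.2 ∂γ.prod η ∂π :=
        lintegral_congr fun m => (lintegral_prod_symm _ (hΦ m).aemeasurable).symm
    _ ≤ ∫⁻ _, θ ∂π := lintegral_mono h
    _ = θ := by simp

theorem exists_decoder [Fintype M] [DecidableEq M] {out : C → M → E → Y}
    {T : C → M → Set Y} (hT : ∀ c m, MeasurableSet (T c m))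
    (hhit : ∀ m m', MeasurableSet {q : C × E | out q.1 m q.2 ∈ T q.1 m'})
    {p : C → M → E → ℝ≥0∞} (hp : ∀ m, Measurable fun q : C × E => p q.1 m q.2)
    (h : ∀ m, (γ.prod η) {q | out q.1 m q.2 ∉ T q.1 m}
      + ∑ m' ∈ Finset.univ.erase m, (γ.prod η) {q | out q.1 m q.2 ∈ T q.1 m'}
      + ∫⁻ q, p q.1 m q.2 ∂γ.prod η ≤ θ) :
    ∃ (c : C) (dec : Y → M), Measurable dec ∧
      (π.prod η) {ω | dec (out c ω.1 ω.2) ≠ ω.1} + ∫⁻ ω, p c ω.1 ω.2 ∂π.prod η ≤ θ := by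
  let failure : M → Set (C × E) := fun m => {q | out q.1 m q.2 ∉ T q.1 m} ∪
    ⋃ m' ∈ Finset.univ.erase m, {q | out q.1 m q.2 ∈ T q.1 m'}
  have hfailure : ∀ m, MeasurableSet (failure m) := fun m =>
    (hhit m m).compl.union (Finset.measurableSet_biUnion _ fun m' _ => hhit m m')
  have hind : ∀ m, Measurable ((failure m).indicator (1 : C × E → ℝ≥0∞)) := fun m =>
    measurable_one.indicator (hfailure m)
  obtain ⟨c, hc⟩ := exists_lintegral_le_of_forall_lintegral_le (γ := γ) (π := π) (η := η)
    (Φ := fun c m e => (failure m).indicator 1 (c, e) + p c m e) (fun m => (hind m).add (hp m))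
    fun m => by
      rw [lintegral_add_left (hind m), lintegral_indicator_one (hfailure m)]
      refine le_trans (add_le_add_left ?_ _) (h m)
      exact (measure_union_le _ _).trans (add_le_add_right (measure_biUnion_finset_le _ _) _)
  have : Nonempty M := nonempty_of_isProbabilityMeasure π
  obtain ⟨dec, hdec, hsel⟩ := exists_measurable_selection (T c) (hT c)
  refine ⟨c, dec, hdec, le_trans ?_ hc⟩
  have herr : {ω : M × E | dec (out c ω.1 ω.2) ≠ ω.1} ⊆ {ω | (c, ω.2) ∈ failure ω.1} := by
    intro ω hω
    by_contra hnot
    simp only [failure, Set.mem_ofPred_eq, Set.mem_union, Set.mem_iUnion, not_or, not_exists,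
      not_not] at hnot
    refine hω (hsel _ _ hnot.1 fun m' hm' => ?_)
    by_contra hne
    exact hnot.2 m' (Finset.mem_erase.2 ⟨hne, Finset.mem_univ m'⟩) hm'
  have hfail : MeasurableSet {ω : M × E | (c, ω.2) ∈ failure ω.1} :=
    measurableSet_setOfPred.2 (measurable_from_prod_countable_right fun m =>
      measurableSet_setOfPred.1 ((hfailure m).preimage (measurable_prodMk_left (x := c))))
  calc _ ≤ ∫⁻ ω, {ω : M × E | (c, ω.2) ∈ failure ω.1}.indicator 1 ω ∂π.prod η
        + ∫⁻ ω, p c ω.1 ω.2 ∂π.prod η := by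
        rw [lintegral_indicator_one hfail]
        exact add_le_add_left (measure_mono herr) _
    _ = ∫⁻ ω, ((failure ω.1).indicator 1 (c, ω.2) + p c ω.1 ω.2) ∂π.prod η :=
        (lintegral_add_left (measurable_one.indicator hfail) _).symm

end RandomChoice

theorem sum_erase_prod_le {ι κ : Type*} [Fintype ι] [Fintype κ] [DecidableEq ι] [DecidableEq κ]
    {F : ι × κ → ℝ≥0∞} {m : ι × κ} {t₁ t₂ t : ℝ≥0∞} (h₁ : ∀ i, i ≠ m.1 → F (i, m.2) ≤ t₁)
    (h₂ : ∀ j, j ≠ m.2 → F (m.1, j) ≤ t₂) (h : ∀ i j, i ≠ m.1 → j ≠ m.2 → F (i, j) ≤ t) :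
    ∑ m' ∈ Finset.univ.erase m, F m'
      ≤ Fintype.card ι * t₁ + Fintype.card κ * t₂ + Fintype.card ι * Fintype.card κ * t := by
  let U : ι × κ → ℝ≥0∞ := fun m' =>
    (if m'.2 = m.2 then t₁ else 0) + (if m'.1 = m.1 then t₂ else 0) + t
  have hF : ∀ m' ∈ Finset.univ.erase m, F m' ≤ U m' := by
    rintro ⟨i, j⟩ hm'
    by_cases hi : i = m.1
    · subst hi
      have hj : j ≠ m.2 := fun hj => Finset.ne_of_mem_erase hm' (Prod.ext rfl hj)
      simpa [U, hj] using le_add_right (h₂ j hj)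
    · by_cases hj : j = m.2
      · subst hj
        simpa [U, hi] using le_add_right (h₁ i hi)
      · simpa [U, hi, hj] using h i j hi hj
  calc ∑ m' ∈ Finset.univ.erase m, F m' ≤ ∑ m' ∈ Finset.univ.erase m, U m' :=
        Finset.sum_le_sum hF
    _ ≤ ∑ m', U m' := Finset.sum_le_sum_of_subset (Finset.erase_subset _ _)
    _ = _ := by
      simp only [U, Finset.sum_add_distrib]
      rw [Fintype.sum_prod_type, Fintype.sum_prod_type_right]
      simp

section Codebook

variable {A B E Y : Type*} [MeasurableSpace A] [MeasurableSpace B] [MeasurableSpace E]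
  [MeasurableSpace Y] {μ : Measure A} [IsProbabilityMeasure μ] {ν : Measure B}
  [IsProbabilityMeasure ν] {η : Measure E} [IsProbabilityMeasure η] {f : A × (B × E) → Y}
  (hf : Measurable f) {T : Set (A × (B × Y))}
  (hT : MeasurableSet T) {t₁ t₂ t : ℝ≥0∞} (h₁ : ∀ b y, μ {a | (a, b, y) ∈ T} ≤ t₁)
  (h₂ : ∀ a y, ν {b | (a, b, y) ∈ T} ≤ t₂) (h : ∀ y, (μ.prod ν) {q | (q.1, q.2, y) ∈ T} ≤ t)
  {ι κ : Type*} [Fintype ι] [Fintype κ]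
include hf hT h₁ h₂ h

theorem sum_collision_le [DecidableEq ι] [DecidableEq κ] (m : ι × κ) :
    ∑ m' ∈ Finset.univ.erase m,
        (((Measure.pi fun _ : ι => μ).prod (Measure.pi fun _ : κ => ν)).prod η)
          {q | (q.1.1 m'.1, q.1.2 m'.2, f (q.1.1 m.1, q.1.2 m.2, q.2)) ∈ T}
      ≤ Fintype.card ι * t₁ + Fintype.card κ * t₂ + Fintype.card ι * Fintype.card κ * t := by
  refine sum_erase_prod_le (fun i hi => ?_) (fun j hj => ?_) fun i j hi hj => ?_
  · refine measure_preimage_le_of_forall_slice_le μ (μ.prod (ν.prod η))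
      (measurePreserving_fresh_codeword₁ μ ν η hi m.2)
      (S := {x | (x.1, x.2.2.1, f x.2) ∈ T}) (hT.preimage ?_) fun y => h₁ y.2.1 (f y)
    exact measurable_fst.prodMk (measurable_snd.snd.fst.prodMk (hf.comp measurable_snd))
  · refine measure_preimage_le_of_forall_slice_le ν (μ.prod (ν.prod η))
      (measurePreserving_fresh_codeword₂ μ ν η m.1 hj)
      (S := {x | (x.2.1, x.1, f x.2) ∈ T}) (hT.preimage ?_) fun y => h₂ y.1 (f y)
    exact measurable_snd.fst.prodMk (measurable_fst.prodMk (hf.comp measurable_snd))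
  · refine measure_preimage_le_of_forall_slice_le (μ.prod ν) (μ.prod (ν.prod η))
      (measurePreserving_fresh_codewords μ ν η hi hj)
      (S := {x | (x.1.1, x.1.2, f x.2) ∈ T}) (hT.preimage ?_) fun y => h (f y)
    exact measurable_fst.fst.prodMk (measurable_fst.snd.prodMk (hf.comp measurable_snd))

theorem exists_codebook [MeasurableSpace ι] [MeasurableSpace κ] [MeasurableSingletonClass ι]
    [MeasurableSingletonClass κ] (π : Measure (ι × κ)) [IsProbabilityMeasure π]
    {p : A × (B × E) → ℝ≥0∞} (hp : Measurable p) :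
    ∃ (a : ι → A) (b : κ → B) (dec : Y → ι × κ), Measurable dec ∧
      (π.prod η) {ω | dec (f (a ω.1.1, b ω.1.2, ω.2)) ≠ ω.1}
          + ∫⁻ ω, p (a ω.1.1, b ω.1.2, ω.2) ∂π.prod η
        ≤ (μ.prod (ν.prod η)) {q | (q.1, q.2.1, f q) ∉ T}
          + (Fintype.card ι * t₁ + Fintype.card κ * t₂ + Fintype.card ι * Fintype.card κ * t)
          + ∫⁻ q, p q ∂μ.prod (ν.prod η) := by
  classical
  have htriple : Measurable fun q : A × (B × E) => (q.1, q.2.1, f q) :=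
    measurable_fst.prodMk (measurable_snd.fst.prodMk hf)
  have hword (m : ι × κ) := measurePreserving_codeword μ ν η m.1 m.2
  obtain ⟨c, dec, hdec, hc⟩ := exists_decoder (π := π) (η := η)
    (γ := (Measure.pi fun _ : ι => μ).prod (Measure.pi fun _ : κ => ν))
    (out := fun c m e => f (c.1 m.1, c.2 m.2, e))
    (T := fun c m => {y | (c.1 m.1, c.2 m.2, y) ∈ T})
    (fun c m => hT.preimage (measurable_const.prodMk (measurable_const.prodMk measurable_id)))
    (fun m m' => hT.preimage
      (((measurable_pi_apply m'.1).comp measurable_fst.fst).prodMk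
        (((measurable_pi_apply m'.2).comp measurable_fst.snd).prodMk
          (hf.comp (hword m).measurable))))
    (p := fun c m e => p (c.1 m.1, c.2 m.2, e)) (fun m => hp.comp (hword m).measurable)
    fun m => by
      exact add_le_add (add_le_add
        ((hword m).measure_preimage (htriple hT.compl).nullMeasurableSet).le
        (sum_collision_le hf hT h₁ h₂ h m)) ((hword m).lintegral_comp hp).le
  exact ⟨c.1, c.2, dec, hdec, hc⟩

end Codebook

/-! ### Block codes for memoryless channels -/

theorem isProbabilityMeasure_messageLaw {k₁ k₂ : ℕ} (h₁ : 0 < k₁) (h₂ : 0 < k₂) :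
    IsProbabilityMeasure (messageLaw k₁ k₂) := by
  have : Nonempty (Fin k₁) := ⟨⟨0, h₁⟩⟩
  have : Nonempty (Fin k₂) := ⟨⟨0, h₂⟩⟩
  unfold messageLaw
  infer_instance

/-- Codewords of length `k` for two transmitters with input alphabets `A` and `B`, and a decoder
for the output alphabet `Y`. -/
structure BlockCode (k : ℕ) (A B Y : Type*) [MeasurableSpace Y] where
  size₁ : ℕ
  size₂ : ℕ
  size₁_pos : 0 < size₁
  size₂_pos : 0 < size₂
  word₁ : Fin size₁ → Fin k → A
  word₂ : Fin size₂ → Fin k → B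
  dec : (Fin k → Y) → Fin size₁ × Fin size₂
  measurable_dec : Measurable dec

namespace BlockCode

variable {k : ℕ} {A B E Y : Type*} [MeasurableSpace E] [MeasurableSpace Y] (c : BlockCode k A B Y)

/-- The pairs of messages together with the noise of the block. -/
abbrev Outcome (E : Type*) : Type _ := (Fin c.size₁ × Fin c.size₂) × (Fin k → E)

/-- Uniform messages, and independent noise of law `η` in each use of the channel. -/
noncomputable def law (η : Measure E) : Measure (c.Outcome E) :=
  (messageLaw c.size₁ c.size₂).prod (Measure.pi fun _ => η)

instance (η : Measure E) [IsProbabilityMeasure η] : IsProbabilityMeasure (c.law η) := by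
  have := isProbabilityMeasure_messageLaw c.size₁_pos c.size₂_pos
  unfold law
  infer_instance

/-- The two inputs and the noise in each use of the channel. -/
def letters (ω : c.Outcome E) (t : Fin k) : A × (B × E) :=
  (c.word₁ ω.1.1 t, c.word₂ ω.1.2 t, ω.2 t)

theorem measurable_letters [MeasurableSpace A] [MeasurableSpace B] (t : Fin k) :
    Measurable fun ω : c.Outcome E => c.letters ω t :=
  measurable_from_prod_countable_right fun m => by
    unfold letters
    fun_prop

/-- The probability of a decoding error over the memoryless channel `f` with noise law `η`. -/
noncomputable def errorProb (f : A × (B × E) → Y) (η : Measure E) : ℝ≥0∞ :=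
  c.law η {ω | c.dec (fun t => f (c.letters ω t)) ≠ ω.1}

end BlockCode

theorem ceil_exp_le {x : ℝ} (hx : 0 ≤ x) : (⌈Real.exp x⌉₊ : ℝ) ≤ 2 * Real.exp x := by
  have h1 := (Nat.ceil_lt_add_one (Real.exp_nonneg x)).le
  have h2 := Real.one_le_exp hx
  linarith

theorem tendsto_ceil_exp_mul_exp_neg {R τ : ℝ} (hR : 0 ≤ R) (h : R < τ) :
    Tendsto (fun k : ℕ => (⌈Real.exp (k * R)⌉₊ : ℝ≥0∞) * ENNReal.ofReal (Real.exp (-(k * τ))))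
      atTop (𝓝 0) := by
  have hlim : Tendsto (fun k : ℕ => ENNReal.ofReal (2 * Real.exp (k * (R - τ)))) atTop (𝓝 0) := by
    have h' := ENNReal.tendsto_ofReal ((Real.tendsto_exp_atBot.comp
      (tendsto_natCast_atTop_atTop.atTop_mul_const_of_neg (sub_neg.2 h))).const_mul 2)
    rwa [mul_zero, ENNReal.ofReal_zero] at h'
  refine tendsto_of_tendsto_of_tendsto_of_le_of_le tendsto_const_nhds hlim (fun _ => zero_le)
    fun k => ?_
  dsimp only
  rw [← ENNReal.ofReal_natCast, ← ENNReal.ofReal_mul (Nat.cast_nonneg _)]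
  refine ENNReal.ofReal_le_ofReal ?_
  calc (⌈Real.exp (k * R)⌉₊ : ℝ) * Real.exp (-(k * τ))
      ≤ 2 * Real.exp (k * R) * Real.exp (-(k * τ)) :=
        mul_le_mul_of_nonneg_right (ceil_exp_le (by positivity)) (Real.exp_nonneg _)
    _ = 2 * Real.exp (k * (R - τ)) := by
        rw [mul_assoc, ← Real.exp_add]
        ring_nf

theorem tendsto_ceil_exp_mul_ceil_exp_mul_exp_neg {R₁ R₂ τ : ℝ} (h₁ : 0 ≤ R₁) (h₂ : 0 ≤ R₂)
    (h : R₁ + R₂ < τ) :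
    Tendsto (fun k : ℕ => (⌈Real.exp (k * R₁)⌉₊ : ℝ≥0∞) * ⌈Real.exp (k * R₂)⌉₊
      * ENNReal.ofReal (Real.exp (-(k * τ)))) atTop (𝓝 0) := by
  obtain ⟨τ₁, hτ₁, hτ₁'⟩ := exists_between (lt_sub_iff_add_lt.2 h)
  have hprod := ENNReal.Tendsto.mul (tendsto_ceil_exp_mul_exp_neg h₁ hτ₁)
    (Or.inr ENNReal.zero_ne_top) (tendsto_ceil_exp_mul_exp_neg h₂ (lt_sub_comm.1 hτ₁'))
    (Or.inr ENNReal.zero_ne_top)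
  rw [mul_zero] at hprod
  refine hprod.congr fun k => ?_
  rw [mul_mul_mul_comm, ← ENNReal.ofReal_mul (Real.exp_nonneg _), ← Real.exp_add]
  ring_nf

section Coding

variable {A B E Y : Type*} [MeasurableSpace A] [MeasurableSpace B] [MeasurableSpace E]
  [MeasurableSpace Y]

/-- Scores for threshold decoding on the memoryless channel `f` with input laws `μ`, `ν` and noise
law `η`. They play the part of the information densities of the first user, of the second user
and of both: their exponentials average to at most `1` over inputs independent of the output. -/
structure DecodingScores (μ : Measure A) (ν : Measure B) (η : Measure E)
    (f : A × (B × E) → Y) where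
  score₁ : A × (B × Y) → ℝ
  score₂ : A × (B × Y) → ℝ
  score : A × (B × Y) → ℝ
  measurable₁ : Measurable score₁
  measurable₂ : Measurable score₂
  measurable : Measurable score
  integrable₁ : Integrable (fun q => score₁ (q.1, q.2.1, f q)) (μ.prod (ν.prod η))
  integrable₂ : Integrable (fun q => score₂ (q.1, q.2.1, f q)) (μ.prod (ν.prod η))
  integrable : Integrable (fun q => score (q.1, q.2.1, f q)) (μ.prod (ν.prod η))
  lintegral_exp₁_le : ∀ b y, ∫⁻ a, ENNReal.ofReal (Real.exp (score₁ (a, b, y))) ∂μ ≤ 1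
  lintegral_exp₂_le : ∀ a y, ∫⁻ b, ENNReal.ofReal (Real.exp (score₂ (a, b, y))) ∂ν ≤ 1
  lintegral_exp_le : ∀ y,
    ∫⁻ q, ENNReal.ofReal (Real.exp (score (q.1, q.2, y))) ∂(μ.prod ν) ≤ 1

namespace DecodingScores

variable {μ : Measure A} {ν : Measure B} {η : Measure E} {f : A × (B × E) → Y}
  (s : DecodingScores μ ν η f)

/-- The mean score of the input of the first user that was sent. -/
noncomputable def mean₁ : ℝ := ∫ q, s.score₁ (q.1, q.2.1, f q) ∂μ.prod (ν.prod η)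

/-- The mean score of the input of the second user that was sent. -/
noncomputable def mean₂ : ℝ := ∫ q, s.score₂ (q.1, q.2.1, f q) ∂μ.prod (ν.prod η)

/-- The mean score of the pair of inputs that was sent. -/
noncomputable def mean : ℝ := ∫ q, s.score (q.1, q.2.1, f q) ∂μ.prod (ν.prod η)

/-- The blocks of inputs and outputs all of whose scores pass the thresholds. -/
def thresholdSet (τ₁ τ₂ τ : ℝ) (k : ℕ) : Set ((Fin k → A) × ((Fin k → B) × (Fin k → Y))) :=
  {x | k * τ₁ ≤ ∑ t, s.score₁ (x.1 t, x.2.1 t, x.2.2 t)} ∩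
    ({x | k * τ₂ ≤ ∑ t, s.score₂ (x.1 t, x.2.1 t, x.2.2 t)} ∩
      {x | k * τ ≤ ∑ t, s.score (x.1 t, x.2.1 t, x.2.2 t)})

theorem measurableSet_thresholdSet (τ₁ τ₂ τ : ℝ) (k : ℕ) :
    MeasurableSet (s.thresholdSet τ₁ τ₂ τ k) := by
  have h₁ := s.measurable₁
  have h₂ := s.measurable₂
  have h := s.measurable
  exact (measurableSet_le measurable_const (by fun_prop)).inter
    ((measurableSet_le measurable_const (by fun_prop)).inter
      (measurableSet_le measurable_const (by fun_prop)))

variable [IsProbabilityMeasure μ] [IsProbabilityMeasure ν] [IsProbabilityMeasure η]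

theorem tendsto_measure_notMem_thresholdSet (hf : Measurable f) {τ₁ τ₂ τ : ℝ} (h₁ : τ₁ < s.mean₁)
    (h₂ : τ₂ < s.mean₂) (h : τ < s.mean) :
    Tendsto (fun k : ℕ => (Measure.pi fun _ : Fin k => μ.prod (ν.prod η))
      {x | ((fun t => (x t).1), (fun t => (x t).2.1), fun t => f (x t)) ∉
        s.thresholdSet τ₁ τ₂ τ k}) atTop (𝓝 0) := by
  have htriple : Measurable fun q : A × (B × E) => (q.1, q.2.1, f q) := by fun_prop
  have hsum := ((tendsto_measure_pi_sum_lt _ (s.measurable₁.comp htriple) s.integrable₁ h₁).add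
    ((tendsto_measure_pi_sum_lt _ (s.measurable₂.comp htriple) s.integrable₂ h₂).add
      (tendsto_measure_pi_sum_lt _ (s.measurable.comp htriple) s.integrable h)))
  simp only [add_zero] at hsum
  refine tendsto_of_tendsto_of_tendsto_of_le_of_le tendsto_const_nhds hsum (fun _ => zero_le)
    fun k => ?_
  refine (measure_mono fun x hx => ?_).trans ((measure_union_le _ _).trans
    (add_le_add_right (measure_union_le _ _) _))
  simpa only [thresholdSet, Set.mem_ofPred_eq, Set.mem_inter_iff, Set.mem_union, not_and_or,
    not_le, Function.comp_apply] using hx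

theorem exists_blockCode (hf : Measurable f) (τ₁ τ₂ τ : ℝ) {k M₁ M₂ : ℕ} (hM₁ : 0 < M₁)
    (hM₂ : 0 < M₂) {p : (Fin k → A × (B × E)) → ℝ≥0∞} (hp : Measurable p) :
    ∃ c : BlockCode k A B Y, c.size₁ = M₁ ∧ c.size₂ = M₂ ∧
      c.errorProb f η + ∫⁻ ω, p (c.letters ω) ∂c.law η
        ≤ (Measure.pi fun _ : Fin k => μ.prod (ν.prod η))
            {x | ((fun t => (x t).1), (fun t => (x t).2.1), fun t => f (x t)) ∉
              s.thresholdSet τ₁ τ₂ τ k}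
          + (M₁ * ENNReal.ofReal (Real.exp (-(k * τ₁)))
            + M₂ * ENNReal.ofReal (Real.exp (-(k * τ₂)))
            + M₁ * M₂ * ENNReal.ofReal (Real.exp (-(k * τ))))
          + ∫⁻ x, p x ∂(Measure.pi fun _ : Fin k => μ.prod (ν.prod η)) := by
  have m₁ := s.measurable₁
  have m₂ := s.measurable₂
  have m := s.measurable
  have hzip := measurePreserving_zip₃ μ ν η (Fin k)
  have hT := s.measurableSet_thresholdSet τ₁ τ₂ τ k
  have := isProbabilityMeasure_messageLaw hM₁ hM₂
  obtain ⟨a, b, dec, hdec, hc⟩ := exists_codebook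
    (f := fun x : (Fin k → A) × ((Fin k → B) × (Fin k → E)) => fun t => f (x.1 t, x.2.1 t, x.2.2 t))
    (by fun_prop) hT
    (fun b y => (measure_mono fun x hx => hx.1).trans
      (measure_pi_le_sum_le_exp_neg μ (h := fun t x => s.score₁ (x, b t, y t))
        (fun t => by fun_prop) (fun t => s.lintegral_exp₁_le _ _) _))
    (fun a y => (measure_mono fun x hx => hx.2.1).trans
      (measure_pi_le_sum_le_exp_neg ν (h := fun t x => s.score₂ (a t, x, y t))
        (fun t => by fun_prop) (fun t => s.lintegral_exp₂_le _ _) _))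
    (fun y => (measure_mono fun x hx => hx.2.2).trans
      (measure_prod_pi_le_sum_le_exp_neg μ ν (h := fun t x => s.score (x.1, x.2, y t))
        (fun t => by fun_prop) (fun t => s.lintegral_exp_le _) _))
    (messageLaw M₁ M₂) (η := Measure.pi fun _ : Fin k => η) (hp.comp hzip.measurable)
  refine ⟨⟨M₁, M₂, hM₁, hM₂, a, b, dec, hdec⟩, rfl, rfl, hc.trans (le_of_eq ?_)⟩
  have hmiss : MeasurableSet {x : Fin k → A × (B × E) |
      ((fun t => (x t).1), (fun t => (x t).2.1), fun t => f (x t)) ∉ s.thresholdSet τ₁ τ₂ τ k} :=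
    hT.compl.preimage (by fun_prop)
  rw [← hzip.measure_preimage hmiss.nullMeasurableSet, ← hzip.lintegral_comp hp]
  simp only [Fintype.card_fin]
  rfl

theorem exists_blockCodes (hf : Measurable f) {J : Type*} [Finite J] {p : J → A × (B × E) → ℝ}
    (hp : ∀ j, Measurable (p j)) (hi : ∀ j, Integrable (p j) (μ.prod (ν.prod η))) {R₁ R₂ : ℝ}
    (hR₁ : 0 ≤ R₁) (hR₂ : 0 ≤ R₂) (h₁ : R₁ < s.mean₁) (h₂ : R₂ < s.mean₂)
    (h : R₁ + R₂ < s.mean) :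
    ∃ c : ∀ k, BlockCode k A B Y, (∀ k : ℕ, Real.exp (k * R₁) ≤ (c k).size₁) ∧
      (∀ k : ℕ, Real.exp (k * R₂) ≤ (c k).size₂) ∧
      Tendsto (fun k => (c k).errorProb f η) atTop (𝓝 0) ∧
      ∀ j, Tendsto (fun k => ∫⁻ ω, averageDev (μ.prod (ν.prod η)) (p j) ((c k).letters ω)
        ∂(c k).law η) atTop (𝓝 0) := by
  cases nonempty_fintype J
  obtain ⟨τ₁, hτ₁, hτ₁'⟩ := exists_between h₁
  obtain ⟨τ₂, hτ₂, hτ₂'⟩ := exists_between h₂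
  obtain ⟨τ, hτ, hτ'⟩ := exists_between h
  have hdev (j : J) (k : ℕ) := measurable_averageDev (μ.prod (ν.prod η)) (hp j) k
  choose c hc₁ hc₂ hc using fun k : ℕ => s.exists_blockCode hf τ₁ τ₂ τ (k := k)
    (Nat.ceil_pos.2 (Real.exp_pos (k * R₁))) (Nat.ceil_pos.2 (Real.exp_pos (k * R₂)))
    (p := fun x => ∑ j, averageDev (μ.prod (ν.prod η)) (p j) x)
    (Finset.measurable_fun_sum _ fun j _ => hdev j k)
  have hlim := ((s.tendsto_measure_notMem_thresholdSet hf hτ₁' hτ₂' hτ').add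
    (((tendsto_ceil_exp_mul_exp_neg hR₁ hτ₁).add (tendsto_ceil_exp_mul_exp_neg hR₂ hτ₂)).add
      (tendsto_ceil_exp_mul_ceil_exp_mul_exp_neg hR₁ hR₂ hτ))).add
    (tendsto_finsetSum Finset.univ fun j _ => tendsto_lintegral_averageDev _ (hp j) (hi j))
  simp only [add_zero, Finset.sum_const_zero] at hlim
  simp only [lintegral_finsetSum _ fun j _ => hdev j _] at hc
  have hzero {F : ℕ → ℝ≥0∞} (hF : ∀ k, F k ≤ _) : Tendsto F atTop (𝓝 0) :=
    tendsto_of_tendsto_of_tendsto_of_le_of_le tendsto_const_nhds hlim (fun _ => zero_le) hF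
  refine ⟨c, fun k => ?_, fun k => ?_, hzero fun k => le_self_add.trans (hc k), fun j =>
    hzero fun k => le_trans ?_ (hc k)⟩
  · rw [hc₁]
    exact Nat.le_ceil _
  · rw [hc₂]
    exact Nat.le_ceil _
  · exact (lintegral_mono fun ω => Finset.single_le_sum
      (f := fun j => averageDev (μ.prod (ν.prod η)) (p j) ((c k).letters ω))
      (fun _ _ => zero_le) (Finset.mem_univ j)).trans le_add_self

end DecodingScores

end Coding

/-! ### Feedback does not hurt -/

instance isProbabilityMeasure_noiseLaw (n : ℕ) (v : ℝ≥0) : IsProbabilityMeasure (noiseLaw n v) := by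
  unfold noiseLaw; infer_instance

theorem powerConstraint_iff_sum_lintegral_le {Ω : Type*} [MeasurableSpace Ω] {μ : Measure Ω}
    {n : ℕ} (hn : 0 < n) {X : Fin n → Ω → ℝ} (P : ℝ≥0) :
    PowerConstraint μ X P ↔ ∑ t, ∫⁻ ω, ENNReal.ofReal (X t ω ^ 2) ∂μ ≤ n * P := by
  have hn' : (n : ℝ≥0∞) ≠ 0 := by exact_mod_cast hn.ne'
  rw [PowerConstraint, mul_comm, ← div_eq_mul_inv,
    ENNReal.div_le_iff_le_mul (Or.inl hn') (Or.inl (ENNReal.natCast_ne_top n)), mul_comm]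

theorem powerConstraint_iff_sum_integral_le {Ω : Type*} [MeasurableSpace Ω] {μ : Measure Ω}
    {n : ℕ} (hn : 0 < n) {X : Fin n → Ω → ℝ} (hX : ∀ t, Integrable (fun ω => X t ω ^ 2) μ)
    (P : ℝ≥0) : PowerConstraint μ X P ↔ ∑ t, ∫ ω, X t ω ^ 2 ∂μ ≤ n * P := by
  have hsum : ∑ t, ∫⁻ ω, ENNReal.ofReal (X t ω ^ 2) ∂μ
      = ENNReal.ofReal (∑ t, ∫ ω, X t ω ^ 2 ∂μ) := by
    rw [ENNReal.ofReal_sum_of_nonneg fun t _ => integral_nonneg fun ω => sq_nonneg _]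
    exact Finset.sum_congr rfl fun t _ =>
      (ofReal_integral_eq_lintegral_ofReal (hX t) (ae_of_all _ fun ω => sq_nonneg _)).symm
  rw [powerConstraint_iff_sum_lintegral_le hn, hsum,
    show (n : ℝ≥0∞) * P = ENNReal.ofReal (n * P) by
      rw [ENNReal.ofReal_mul (Nat.cast_nonneg n), ENNReal.ofReal_natCast,
        ENNReal.ofReal_coe_nnreal]]
  exact ENNReal.ofReal_le_ofReal_iff (by positivity)

namespace NoFeedbackCode

variable {n : ℕ} (c : NoFeedbackCode n)

/-- The code that ignores the feedback. -/
def ignoreFeedback : PartialFeedbackCode n where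
  size₁ := c.size₁
  size₂ := c.size₂
  size₁_pos := c.size₁_pos
  size₂_pos := c.size₂_pos
  enc₁ := c.enc₁
  enc₂ t m _ := c.enc₂ t m
  measurable_enc₂ _ _ := measurable_const
  dec := c.dec
  measurable_dec := c.measurable_dec

theorem isProbabilityMeasure_law (N : ℝ≥0) : IsProbabilityMeasure (c.law N) := by
  have := isProbabilityMeasure_messageLaw c.size₁_pos c.size₂_pos
  unfold law; infer_instance

theorem measurePreserving_forget (N σsq : ℝ≥0) :
    MeasurePreserving (fun ω : c.ignoreFeedback.Outcome => ((ω.1, ω.2.1) : c.Outcome))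
      (c.ignoreFeedback.law N σsq) (c.law N) := by
  have := isProbabilityMeasure_messageLaw c.size₁_pos c.size₂_pos
  exact (MeasurePreserving.id (messageLaw c.size₁ c.size₂)).prod
    (measurePreserving_fst (μ := noiseLaw n N) (ν := noiseLaw n σsq))

theorem measurable_input₁ (t : Fin n) : Measurable (c.input₁ t) :=
  (measurable_of_finite (c.enc₁ t)).comp measurable_fst.fst

theorem measurable_input₂ (t : Fin n) : Measurable (c.input₂ t) :=
  (measurable_of_finite (c.enc₂ t)).comp measurable_fst.snd

theorem measurable_output : Measurable c.output :=
  measurable_pi_lambda _ fun t => ((c.measurable_input₁ t).add (c.measurable_input₂ t)).add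
    ((measurable_pi_apply t).comp measurable_snd)

theorem measurableSet_error : MeasurableSet {ω | c.dec (c.output ω) ≠ ω.1} :=
  (measurableSet_eq_fun (c.measurable_dec.comp c.measurable_output) measurable_fst).compl

theorem ignoreFeedback_output (ω : c.ignoreFeedback.Outcome) :
    c.ignoreFeedback.output ω = c.output (ω.1, ω.2.1) := by
  funext t
  rw [PartialFeedbackCode.output_eq]
  rfl

theorem ignoreFeedback_admissible {P₁ P₂ N : ℝ≥0} (σsq : ℝ≥0) (h : c.Admissible P₁ P₂ N) :
    c.ignoreFeedback.Admissible P₁ P₂ N σsq := by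
  have hmp := c.measurePreserving_forget N σsq
  constructor
  · refine le_trans (le_of_eq ?_) h.1
    congr 1
    exact Finset.sum_congr rfl fun t _ =>
      hmp.lintegral_comp ((c.measurable_input₁ t).pow_const 2).ennreal_ofReal
  · refine le_trans (le_of_eq ?_) h.2
    congr 1
    exact Finset.sum_congr rfl fun t _ =>
      hmp.lintegral_comp ((c.measurable_input₂ t).pow_const 2).ennreal_ofReal

theorem ignoreFeedback_errorProb (N σsq : ℝ≥0) :
    c.ignoreFeedback.errorProb N σsq = c.errorProb N := by
  have h := (c.measurePreserving_forget N σsq).measure_preimage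
    c.measurableSet_error.nullMeasurableSet
  refine Eq.trans ?_ h
  unfold PartialFeedbackCode.errorProb
  congr 1
  ext ω
  simp only [ignoreFeedback_output]
  rfl

end NoFeedbackCode

theorem capacityMAC_subset_capacityPartialFB (P₁ P₂ N σsq : ℝ≥0) :
    capacityMAC P₁ P₂ N ⊆ capacityPartialFB P₁ P₂ N σsq := by
  rintro R ⟨h₁, h₂, h⟩
  refine ⟨h₁, h₂, fun δ hδ => ?_⟩
  obtain ⟨c, hc, herr⟩ := h δ hδ
  refine ⟨fun n => (c n).ignoreFeedback, ?_, ?_⟩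
  · filter_upwards [hc] with n hn
    exact ⟨(c n).ignoreFeedback_admissible σsq hn.1, hn.2⟩
  · simpa only [NoFeedbackCode.ignoreFeedback_errorProb] using herr

/-! ### The converse without feedback -/

theorem lintegral_pi_prod_mul_comp {ι X X' : Type*} [Fintype ι] [MeasurableSpace X]
    [MeasurableSpace X'] (ρ : ι → Measure X) [∀ i, IsProbabilityMeasure (ρ i)]
    (ρ' : ι → Measure X') [∀ i, SigmaFinite (ρ' i)] {w : ι → X → ℝ≥0∞} (hw : ∀ i, Measurable (w i))
    {T : ι → X → X'} (hT : ∀ i, Measurable (T i))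
    (h : ∀ i, ((ρ i).withDensity (w i)).map (T i) = ρ' i) {g : (ι → X') → ℝ≥0∞}
    (hg : Measurable g) :
    ∫⁻ x, (∏ i, w i (x i)) * g (fun i => T i (x i)) ∂Measure.pi ρ = ∫⁻ y, g y ∂Measure.pi ρ' := by
  have hWm : Measurable fun x : ι → X => ∏ i, w i (x i) := by fun_prop
  have hTm : Measurable fun (x : ι → X) i => T i (x i) := by fun_prop
  have hlaw : Measure.pi ρ'
      = ((Measure.pi ρ).withDensity fun x => ∏ i, w i (x i)).map fun x i => T i (x i) := by
    refine Measure.pi_eq fun s hs => ?_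
    have hbox := hTm (MeasurableSet.univ_pi hs)
    rw [Measure.map_apply hTm (.univ_pi hs), withDensity_apply _ hbox, ← lintegral_indicator hbox]
    have hfac : ∀ x : ι → X, ((fun x i => T i (x i)) ⁻¹' Set.univ.pi s).indicator
        (fun x => ∏ i, w i (x i)) x = ∏ i, (T i ⁻¹' s i).indicator (w i) (x i) := by
      classical
      intro x
      simp only [Set.indicator_apply, Finset.prod_ite_zero, Set.mem_preimage, Set.mem_univ_pi,
        Finset.mem_univ, forall_const]
    simp only [hfac]
    rw [lintegral_pi_prod_eq ρ fun i => (hw i).indicator (hT i (hs i))]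
    refine Finset.prod_congr rfl fun i _ => ?_
    rw [lintegral_indicator (hT i (hs i)), ← withDensity_apply _ (hT i (hs i)),
      ← Measure.map_apply (hT i) (hs i), h]
  rw [hlaw, lintegral_map hg hTm,
    lintegral_withDensity_eq_lintegral_mul _ hWm (g := fun x => g fun i => T i (x i)) (hg.comp hTm)]
  rfl

theorem map_withDensity_gaussianReal {N S : ℝ≥0} (hN : 0 < N) (hS : 0 < S) (x m : ℝ) :
    ((gaussianReal 0 N).withDensity fun z =>
        ENNReal.ofReal (Real.exp (logDensity S (x + z - m) - logDensity N z))).map (x + ·)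
      = gaussianReal m S := by
  have hm := measurable_logDensity
  refine Measure.ext_of_lintegral _ fun h hh => ?_
  rw [lintegral_map hh (by fun_prop), lintegral_withDensity_eq_lintegral_mul _ (by fun_prop)
    (g := fun z => h (x + z)) (by fun_prop)]
  simp only [Pi.mul_apply]
  rw [lintegral_gaussianReal hN 0 (by fun_prop), lintegral_gaussianReal hS m hh,
    ← lintegral_add_left_eq_self (fun y => ENNReal.ofReal (Real.exp (logDensity S (y - m))) * h y)
      x]
  refine lintegral_congr fun z => ?_
  rw [← mul_assoc, ← ENNReal.ofReal_mul (Real.exp_nonneg _), ← Real.exp_add, sub_zero,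
    add_sub_cancel]

theorem lintegral_noiseLaw_shift {n : ℕ} {N S : ℝ≥0} (hN : 0 < N) (hS : 0 < S) (x m : Fin n → ℝ)
    {h : (Fin n → ℝ) → ℝ≥0∞} (hh : Measurable h) :
    ∫⁻ z, ENNReal.ofReal (Real.exp (∑ t, (logDensity S (x t + z t - m t) - logDensity N (z t))))
        * h (fun t => x t + z t) ∂noiseLaw n N
      = ∫⁻ y, h y ∂Measure.pi fun t => gaussianReal (m t) S := by
  have hm := measurable_logDensity
  rw [noiseLaw, ← lintegral_pi_prod_mul_comp (fun _ => gaussianReal 0 N) _ (fun t => by fun_prop)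
    (fun t => by fun_prop) (fun t => map_withDensity_gaussianReal hN hS (x t) (m t)) hh]
  simp only [Real.exp_sum, ENNReal.ofReal_prod_of_nonneg fun _ _ => Real.exp_nonneg _]

theorem messageLaw_singleton {k₁ k₂ : ℕ} (m : Fin k₁ × Fin k₂) :
    messageLaw k₁ k₂ {m} = (k₁ : ℝ≥0∞)⁻¹ * (k₂ : ℝ≥0∞)⁻¹ := by
  have : Nonempty (Fin k₁) := ⟨m.1⟩
  have : Nonempty (Fin k₂) := ⟨m.2⟩
  rw [messageLaw, ← Set.singleton_prod_singleton, Measure.prod_prod, uniformOn_univ,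
    uniformOn_univ]
  simp

theorem integral_le_log_of_lintegral_exp_le {Ω : Type*} [MeasurableSpace Ω] {ρ : Measure Ω}
    [IsProbabilityMeasure ρ] {G : Ω → ℝ} (hG : Integrable G ρ) {K : ℝ} (hK : 0 < K)
    (h : ∫⁻ ω, ENNReal.ofReal (Real.exp (G ω)) ∂ρ ≤ ENNReal.ofReal K) :
    ∫ ω, G ω ∂ρ ≤ Real.log K := by
  have hm : AEStronglyMeasurable (fun ω => Real.exp (G ω)) ρ :=
    Real.continuous_exp.comp_aestronglyMeasurable hG.1
  have hnn : 0 ≤ᵐ[ρ] fun ω => Real.exp (G ω) := ae_of_all _ fun ω => Real.exp_nonneg _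
  have hi : Integrable (fun ω => Real.exp (G ω)) ρ :=
    (lintegral_ofReal_ne_top_iff_integrable hm hnn).1 (h.trans_lt ENNReal.ofReal_lt_top).ne
  rw [Real.le_log_iff_exp_le hK]
  calc Real.exp (∫ ω, G ω ∂ρ)
      ≤ ∫ ω, Real.exp (G ω) ∂ρ := convexOn_exp.map_integral_le Real.continuous_exp.continuousOn
        isClosed_univ (ae_of_all _ fun ω => Set.mem_univ _) hG hi
    _ ≤ K := by
        rw [integral_eq_lintegral_of_nonneg_ae hnn hm]
        exact ENNReal.toReal_le_of_le_ofReal hK.le h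

theorem Centered.integrable_logDensity_sub {Ω : Type*} [MeasurableSpace Ω] {ρ : Measure Ω}
    [IsFiniteMeasure ρ] {f g : Ω → ℝ} {v w : ℝ} (hf : Centered ρ f v) (hg : Centered ρ g w)
    (V W : ℝ) : Integrable (fun ω => logDensity V (f ω) - logDensity W (g ω)) ρ :=
  (hf.integrable_logDensity V).sub (hg.integrable_logDensity W)

theorem Centered.integral_logDensity_sub {Ω : Type*} [MeasurableSpace Ω] {ρ : Measure Ω}
    [IsProbabilityMeasure ρ] {f g : Ω → ℝ} {v w V : ℝ} (hf : Centered ρ f v)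
    (hg : Centered ρ g w) (hw : 0 < w) (hV : 0 < V) :
    ∫ ω, (logDensity V (f ω) - logDensity w (g ω)) ∂ρ
      = -(1 / 2 * Real.log (V / w)) + (V - v) / (2 * V) := by
  rw [integral_sub (hf.integrable_logDensity _) (hg.integrable_logDensity _),
    hf.integral_logDensity, hg.integral_logDensity, Real.log_div hV.ne' hw.ne',
    Real.log_mul (by positivity) hV.ne', Real.log_mul (by positivity) hw.ne']
  field_simp
  ring

theorem centered_sub_integral {Ω : Type*} [MeasurableSpace Ω] {ρ : Measure Ω}
    [IsProbabilityMeasure ρ] {x : Ω → ℝ} (hx : MemLp x 2 ρ) :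
    Centered ρ (fun i => x i - ∫ j, x j ∂ρ) (Var[x; ρ]) where
  memLp := hx.sub (memLp_const _)
  mean := by
    rw [integral_sub (hx.integrable (by norm_num)) (integrable_const _)]
    simp
  second := (variance_eq_integral hx.aemeasurable).symm

theorem centered_noiseLaw {n : ℕ} (v : ℝ≥0) (t : Fin n) :
    Centered (noiseLaw n v) (fun z => z t) v := by
  have hmp := measurePreserving_eval (fun _ : Fin n => gaussianReal 0 v) t
  have hg := Centered.gaussianReal v
  refine ⟨hg.memLp.comp_measurePreserving hmp, ?_, ?_⟩
  · rw [← hg.mean, ← hmp.map_eq, integral_map hmp.aemeasurable (by fun_prop)]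
    rfl
  · rw [← hg.second, ← hmp.map_eq, integral_map hmp.aemeasurable (by fun_prop)]
    rfl

theorem sum_variance_le_of_powerConstraint {Ω M : Type*} [MeasurableSpace Ω] [MeasurableSpace M]
    {μ : Measure Ω} {ρ : Measure M} [IsProbabilityMeasure ρ] {π : Ω → M}
    (hπ : MeasurePreserving π μ ρ) {n : ℕ} (hn : 0 < n) {x : Fin n → M → ℝ}
    (hx : ∀ t, MemLp (x t) 2 ρ) {P : ℝ≥0} (h : PowerConstraint μ (fun t ω => x t (π ω)) P) :
    ∑ t, Var[x t; ρ] ≤ n * P := by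
  have hi : ∀ t, Integrable (fun ω => x t (π ω) ^ 2) μ := fun t =>
    hπ.integrable_comp_of_integrable (hx t).integrable_sq
  refine le_trans (Finset.sum_le_sum fun t _ => ?_)
    ((powerConstraint_iff_sum_integral_le hn hi P).1 h)
  calc Var[x t; ρ] ≤ ∫ i, x t i ^ 2 ∂ρ := variance_le_expectation_sq (hx t).1
    _ = ∫ ω, x t (π ω) ^ 2 ∂μ := by
        rw [← hπ.map_eq, integral_map hπ.aemeasurable (by
          rw [hπ.map_eq]; exact (hx t).integrable_sq.1)]

namespace NoFeedbackCode

variable {n : ℕ} (c : NoFeedbackCode n)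

/-- The event that both messages are decoded correctly. -/
def correct : Set c.Outcome := {ω | c.dec (c.output ω) = ω.1}

/-- The log-likelihood ratio between the product of the Gaussian laws of means `m t` and
variance `S` and the law of the output given the messages. -/
noncomputable def logLikelihoodRatio (N S : ℝ≥0) (m : Fin n → ℝ) (ω : c.Outcome) : ℝ :=
  ∑ t, (logDensity S (c.output ω t - m t) - logDensity N (ω.2 t))

/-- The quantity whose exponential moment bounds the sum rate: the number of nats decoded
correctly, minus the information density of the output. -/
noncomputable def fanoScore (N S : ℝ≥0) (m : Fin n → ℝ) (ω : c.Outcome) : ℝ :=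
  c.correct.indicator (fun _ => Real.log (c.size₁ * c.size₂)) ω + c.logLikelihoodRatio N S m ω

theorem measurableSet_correct : MeasurableSet c.correct :=
  measurableSet_eq_fun (c.measurable_dec.comp c.measurable_output) measurable_fst

theorem measurable_fanoScore (N S : ℝ≥0) (m : Fin n → ℝ) : Measurable (c.fanoScore N S m) := by
  have hm := measurable_logDensity
  have hout := c.measurable_output
  exact (measurable_const.indicator c.measurableSet_correct).add
    (Finset.measurable_fun_sum _ fun t _ => by fun_prop)

section Moment

variable {N S : ℝ≥0} (hN : 0 < N) (hS : 0 < S) (m : Fin n → ℝ)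
include hN hS

theorem lintegral_exp_fanoScore_message_le (i : Fin c.size₁ × Fin c.size₂) :
    ∫⁻ z, ENNReal.ofReal (Real.exp (c.fanoScore N S m (i, z))) ∂noiseLaw n N
      ≤ c.size₁ * c.size₂ * (Measure.pi fun t => gaussianReal (m t) S) (c.dec ⁻¹' {i}) + 1 := by
  classical
  set D : Set (Fin n → ℝ) := c.dec ⁻¹' {i}
  have hD : MeasurableSet D := c.measurable_dec (measurableSet_singleton i)
  have hs : (0 : ℝ) < c.size₁ * c.size₂ := by
    exact_mod_cast Nat.mul_pos c.size₁_pos c.size₂_pos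
  let h : (Fin n → ℝ) → ℝ≥0∞ := fun y => if y ∈ D then (c.size₁ * c.size₂ : ℝ≥0∞) else 1
  have hh : Measurable h := Measurable.ite hD measurable_const measurable_const
  calc ∫⁻ z, ENNReal.ofReal (Real.exp (c.fanoScore N S m (i, z))) ∂noiseLaw n N
      = ∫⁻ z, ENNReal.ofReal (Real.exp (c.logLikelihoodRatio N S m (i, z)))
          * h (c.output (i, z)) ∂noiseLaw n N := by
        refine lintegral_congr fun z => ?_
        rw [fanoScore, Real.exp_add, ENNReal.ofReal_mul (Real.exp_nonneg _), mul_comm]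
        congr 1
        by_cases hz : c.output (i, z) ∈ D
        · rw [Set.indicator_of_mem (show (i, z) ∈ c.correct from hz), Real.exp_log hs]
          simp only [h, if_pos hz, ENNReal.ofReal_mul (Nat.cast_nonneg c.size₁),
            ENNReal.ofReal_natCast]
        · rw [Set.indicator_of_notMem (show (i, z) ∉ c.correct from hz), Real.exp_zero,
            ENNReal.ofReal_one]
          simp only [h, if_neg hz]
    _ = ∫⁻ y, h y ∂Measure.pi fun t => gaussianReal (m t) S :=
        lintegral_noiseLaw_shift hN hS (fun t => c.enc₁ t i.1 + c.enc₂ t i.2) m hh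
    _ ≤ ∫⁻ y, (D.indicator (fun _ => (c.size₁ * c.size₂ : ℝ≥0∞)) y + 1)
          ∂Measure.pi fun t => gaussianReal (m t) S := by
        refine lintegral_mono fun y => ?_
        by_cases hy : y ∈ D <;> simp [h, hy]
    _ = c.size₁ * c.size₂ * (Measure.pi fun t => gaussianReal (m t) S) D + 1 := by
        rw [lintegral_add_right _ measurable_const, lintegral_indicator_const hD]
        simp

theorem lintegral_exp_fanoScore_le :
    ∫⁻ ω, ENNReal.ofReal (Real.exp (c.fanoScore N S m ω)) ∂c.law N ≤ 2 := by
  have := isProbabilityMeasure_messageLaw c.size₁_pos c.size₂_pos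
  set Q := Measure.pi fun t => gaussianReal (m t) S
  rw [law, lintegral_prod _ (c.measurable_fanoScore N S m).exp.ennreal_ofReal.aemeasurable]
  refine (lintegral_mono (c.lintegral_exp_fanoScore_message_le hN hS m)).trans ?_
  rw [lintegral_add_right _ measurable_const, lintegral_fintype]
  simp only [messageLaw_singleton, lintegral_const, measure_univ, mul_one]
  have hsum : ∑ i, Q (c.dec ⁻¹' {i}) = 1 := by
    have h := sum_measure_preimage_singleton (μ := Q) Finset.univ (f := c.dec)
      fun i _ => c.measurable_dec (measurableSet_singleton i)
    simpa only [Finset.coe_univ, Set.preimage_univ, measure_univ] using h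
  have hcancel : ∀ {k : ℕ}, 0 < k → (k : ℝ≥0∞) * (k : ℝ≥0∞)⁻¹ = 1 := fun hk =>
    ENNReal.mul_inv_cancel (by exact_mod_cast hk.ne') (ENNReal.natCast_ne_top _)
  have hterm : ∀ i, c.size₁ * c.size₂ * Q (c.dec ⁻¹' {i})
      * ((c.size₁ : ℝ≥0∞)⁻¹ * (c.size₂ : ℝ≥0∞)⁻¹) = Q (c.dec ⁻¹' {i}) := fun i => by
    rw [mul_right_comm, mul_mul_mul_comm, hcancel c.size₁_pos, hcancel c.size₂_pos, one_mul,
      one_mul]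
  rw [Finset.sum_congr rfl fun i _ => hterm i, hsum, one_add_one_eq_two]

end Moment

/-- The mean of the output. -/
noncomputable def meanOutput (t : Fin n) : ℝ :=
  ∫ i, c.enc₁ t i ∂uniformOn Set.univ + ∫ i, c.enc₂ t i ∂uniformOn Set.univ

theorem centered_output_sub_meanOutput (N : ℝ≥0) (t : Fin n) :
    Centered (c.law N) (fun ω => c.output ω t - c.meanOutput t)
      (Var[c.enc₁ t; uniformOn Set.univ] + Var[c.enc₂ t; uniformOn Set.univ] + N) := by
  have := Fin.pos_iff_nonempty.1 c.size₁_pos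
  have := Fin.pos_iff_nonempty.1 c.size₂_pos
  refine (((centered_sub_integral .of_discrete).prod (centered_sub_integral .of_discrete)).prod
    (centered_noiseLaw N t)).congr (fun ω => ?_) rfl
  simp only [output, input₁, input₂, meanOutput]
  ring

theorem centered_noise (N : ℝ≥0) (t : Fin n) : Centered (c.law N) (fun ω => ω.2 t) N := by
  have := isProbabilityMeasure_messageLaw c.size₁_pos c.size₂_pos
  have h₀ : Centered (messageLaw c.size₁ c.size₂) (fun _ => 0) 0 := ⟨.zero', by simp, by simp⟩
  exact (h₀.prod (centered_noiseLaw N t)).congr (fun ω => zero_add _) (zero_add _)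

theorem sum_variance_le {P₁ P₂ N : ℝ≥0} (hn : 0 < n) (h : c.Admissible P₁ P₂ N) :
    ∑ t, (Var[c.enc₁ t; uniformOn Set.univ] + Var[c.enc₂ t; uniformOn Set.univ])
      ≤ n * (P₁ + P₂) := by
  have := Fin.pos_iff_nonempty.1 c.size₁_pos
  have := Fin.pos_iff_nonempty.1 c.size₂_pos
  have h₁ := sum_variance_le_of_powerConstraint (measurePreserving_fst.comp measurePreserving_fst)
    hn (fun t => .of_discrete) h.1
  have h₂ := sum_variance_le_of_powerConstraint (measurePreserving_snd.comp measurePreserving_fst)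
    hn (fun t => .of_discrete) h.2
  rw [Finset.sum_add_distrib, mul_add]
  exact add_le_add h₁ h₂

theorem integrable_logLikelihoodRatio (N S : ℝ≥0) :
    Integrable (c.logLikelihoodRatio N S c.meanOutput) (c.law N) := by
  have := c.isProbabilityMeasure_law N
  exact integrable_finsetSum _ fun t _ =>
    (c.centered_output_sub_meanOutput N t).integrable_logDensity_sub (c.centered_noise N t) _ _

theorem neg_le_integral_logLikelihoodRatio {P₁ P₂ N : ℝ≥0} (hN : 0 < N) (hn : 0 < n)
    (h : c.Admissible P₁ P₂ N) :
    -(n * (1 / 2 * Real.log (1 + ((P₁ : ℝ) + P₂) / N)))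
      ≤ ∫ ω, c.logLikelihoodRatio N (P₁ + P₂ + N) c.meanOutput ω ∂c.law N := by
  have := c.isProbabilityMeasure_law N
  set S : ℝ≥0 := P₁ + P₂ + N with hS
  have hN' : (0 : ℝ) < N := hN
  have hSpos : (0 : ℝ) < S := NNReal.coe_pos.2 (by positivity)
  have hratio : (S : ℝ) / N = 1 + ((P₁ : ℝ) + P₂) / N := by
    rw [hS, NNReal.coe_add, NNReal.coe_add, add_div, div_self hN'.ne', add_comm]
  have hV := c.sum_variance_le hn h
  set V : Fin n → ℝ := fun t =>
    Var[c.enc₁ t; uniformOn Set.univ] + Var[c.enc₂ t; uniformOn Set.univ]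
  have hmean : ∫ ω, c.logLikelihoodRatio N S c.meanOutput ω ∂c.law N
      = ∑ t, (-(1 / 2 * Real.log (S / N)) + (S - (V t + N)) / (2 * S)) := by
    simp only [logLikelihoodRatio]
    rw [integral_finsetSum _ fun t _ =>
      (c.centered_output_sub_meanOutput N t).integrable_logDensity_sub (c.centered_noise N t) _ _]
    exact Finset.sum_congr rfl fun t _ =>
      (c.centered_output_sub_meanOutput N t).integral_logDensity_sub (c.centered_noise N t) hN'
        hSpos
  rw [hmean, Finset.sum_add_distrib, ← Finset.sum_div, Finset.sum_sub_distrib,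
    Finset.sum_add_distrib, hratio]
  simp only [Finset.sum_const, Finset.card_univ, Fintype.card_fin, nsmul_eq_mul, mul_neg,
    le_neg_add_iff_add_le, add_neg_cancel]
  refine div_nonneg (sub_nonneg.2 ?_) (by positivity)
  rw [hS]
  push_cast
  linarith

theorem integral_indicator_correct (N : ℝ≥0) (K : ℝ) :
    ∫ ω, c.correct.indicator (fun _ => K) ω ∂c.law N = K * (1 - (c.errorProb N).toReal) := by
  have := c.isProbabilityMeasure_law N
  rw [integral_indicator_const _ c.measurableSet_correct, smul_eq_mul, mul_comm]
  congr 1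
  exact (congrArg (c.law N).real (compl_compl c.correct)).symm.trans
    (probReal_compl_eq_one_sub c.measurableSet_error)

theorem log_size_mul_le {P₁ P₂ N : ℝ≥0} (hN : 0 < N) (hn : 0 < n) (h : c.Admissible P₁ P₂ N) :
    Real.log (c.size₁ * c.size₂) * (1 - (c.errorProb N).toReal)
      ≤ n * (1 / 2 * Real.log (1 + ((P₁ : ℝ) + P₂) / N)) + Real.log 2 := by
  have := c.isProbabilityMeasure_law N
  have hi : Integrable (c.correct.indicator fun _ => Real.log (c.size₁ * c.size₂)) (c.law N) :=
    (integrable_const _).indicator c.measurableSet_correct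
  have hL := c.integrable_logLikelihoodRatio N (P₁ + P₂ + N)
  have hmoment := integral_le_log_of_lintegral_exp_le (hi.add hL) two_pos
    ((c.lintegral_exp_fanoScore_le hN (by positivity) c.meanOutput).trans_eq (by simp))
  rw [integral_add' hi hL, c.integral_indicator_correct] at hmoment
  linarith [c.neg_le_integral_logLikelihoodRatio hN hn h]

end NoFeedbackCode

theorem add_le_of_mem_capacityMAC {P₁ P₂ N : ℝ≥0} (hN : 0 < N) {R : ℝ × ℝ}
    (hR : R ∈ capacityMAC P₁ P₂ N) :
    R.1 + R.2 ≤ 1 / 2 * Real.log (1 + ((P₁ : ℝ) + P₂) / N) := by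
  refine le_of_forall_pos_le_add fun ε hε => ?_
  obtain ⟨c, hc, herr⟩ := hR.2.2 (ε / 2) (half_pos hε)
  have herr' : Tendsto (fun n => (R.1 + R.2 - ε) * (1 - ((c n).errorProb N).toReal)) atTop
      (𝓝 ((R.1 + R.2 - ε) * (1 - 0))) :=
    (((ENNReal.tendsto_toReal ENNReal.zero_ne_top).comp herr).const_sub 1).const_mul _
  have hinv : Tendsto (fun n : ℕ => 1 / 2 * Real.log (1 + ((P₁ : ℝ) + P₂) / N)
      + Real.log 2 / n) atTop (𝓝 (1 / 2 * Real.log (1 + ((P₁ : ℝ) + P₂) / N) + 0)) :=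
    (tendsto_const_div_atTop_nhds_zero_nat _).const_add _
  have hle : ∀ᶠ n in atTop, (R.1 + R.2 - ε) * (1 - ((c n).errorProb N).toReal)
      ≤ 1 / 2 * Real.log (1 + ((P₁ : ℝ) + P₂) / N) + Real.log 2 / n := by
    filter_upwards [hc, eventually_gt_atTop 0] with n ⟨hadm, h₁, h₂⟩ hn
    have hn' : (0 : ℝ) < n := by exact_mod_cast hn
    have := (c n).isProbabilityMeasure_law N
    have hp : ((c n).errorProb N).toReal ≤ 1 := measureReal_le_one
    have hfano := (c n).log_size_mul_le hN hn hadm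
    have hs₁ : ((c n).size₁ : ℝ) ≠ 0 := by exact_mod_cast (c n).size₁_pos.ne'
    have hs₂ : ((c n).size₂ : ℝ) ≠ 0 := by exact_mod_cast (c n).size₂_pos.ne'
    rw [Real.log_mul hs₁ hs₂] at hfano
    unfold NoFeedbackCode.rate₁ at h₁
    unfold NoFeedbackCode.rate₂ at h₂
    have hrate : R.1 + R.2 - ε ≤ (Real.log (c n).size₁ + Real.log (c n).size₂) / n := by
      rw [add_div]
      rw [one_div_mul_eq_div] at h₁ h₂
      linarith
    refine (mul_le_mul_of_nonneg_right hrate (sub_nonneg.2 hp)).trans ?_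
    rw [div_mul_eq_mul_div, div_le_iff₀ hn']
    refine hfano.trans (le_of_eq ?_)
    field_simp
  have := le_of_tendsto_of_tendsto herr' hinv hle
  linarith

/-! ### A linear feedback scheme over two channel uses -/

namespace Centered

variable {X : Type*} [MeasurableSpace X] {ρ : Measure X} [IsProbabilityMeasure ρ]

theorem integral_logDensity_sub_add {f f' g g' : X → ℝ} {v v' w w' : ℝ} (hf : Centered ρ f v)
    (hf' : Centered ρ f' v') (hg : Centered ρ g w) (hg' : Centered ρ g' w') (hv : 0 < v)
    (hv' : 0 < v') (hw : 0 < w) (hw' : 0 < w') :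
    ∫ x, (logDensity v (f x) - logDensity v' (f' x)
        + (logDensity w (g x) - logDensity w' (g' x))) ∂ρ
      = 1 / 2 * Real.log (v' * w' / (v * w)) := by
  rw [integral_add (hf.integrable_logDensity_sub hf' v v') (hg.integrable_logDensity_sub hg' w w'),
    hf.integral_logDensity_sub hf' hv' hv, hg.integral_logDensity_sub hg' hw' hw,
    Real.log_div hv.ne' hv'.ne', Real.log_div hw.ne' hw'.ne',
    Real.log_div (by positivity) (by positivity), Real.log_mul hv.ne' hw.ne',
    Real.log_mul hv'.ne' hw'.ne']
  ring

end Centered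

/-- The law of a pair of independent centred Gaussian symbols of variance `Q`. -/
noncomputable abbrev symbolLaw (Q : ℝ≥0) : Measure (ℝ × ℝ) :=
  (gaussianReal 0 Q).prod (gaussianReal 0 Q)

/-- The law of the noise `(z₁, z₂, w₁)` in two channel uses; the feedback noise of the second use
is never observed. -/
noncomputable abbrev blockNoiseLaw (N σsq : ℝ≥0) : Measure (ℝ × (ℝ × ℝ)) :=
  (gaussianReal 0 N).prod ((gaussianReal 0 N).prod (gaussianReal 0 σsq))

/-- A linear scheme over two channel uses with noise variance `N` and feedback noise variance `σsq`.
Transmitter 1 sends `a₁` and then `α a₁ + α' a₂`; Transmitter 2 sends `b₁` and then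
`-β b₁ + γ b₂ + κ (V - b₁)`, where `V` is the feedback output of the first use. The symbols `a₁, a₂`
have variance `Q₁` and `b₁, b₂` have variance `Q₂`. -/
structure LinearScheme (N σsq : ℝ≥0) where
  (Q₁ Q₂ : ℝ≥0)
  (α α' β γ κ : ℝ)
  Q₁_pos : 0 < Q₁
  Q₂_pos : 0 < Q₂
  /-- The second input of Transmitter 1 has variance `Q₁`. -/
  sq_add_sq : α ^ 2 + α' ^ 2 = 1
  /-- The second input of Transmitter 2 has variance `Q₂`. -/
  power_balance : (β ^ 2 + γ ^ 2) * Q₂ + κ ^ 2 * (Q₁ + N + σsq) = Q₂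
  /-- The two channel outputs are uncorrelated. -/
  decorrelation : β * Q₂ = α * Q₁ + κ * (Q₁ + N)

namespace LinearScheme

variable {N σsq : ℝ≥0} (s : LinearScheme N σsq)

/-- The second input of Transmitter 1. -/
def second₁ (a : ℝ × ℝ) : ℝ := s.α * a.1 + s.α' * a.2

/-- The second input of Transmitter 2, given the first feedback output. -/
def second₂ (b : ℝ × ℝ) (v : ℝ) : ℝ := -s.β * b.1 + s.γ * b.2 + s.κ * (v - b.1)

/-- The two channel outputs, as a function of the symbols `(a, b)` and the noise `(z₁, z₂, w₁)`. -/
def channel (q : (ℝ × ℝ) × ((ℝ × ℝ) × (ℝ × (ℝ × ℝ)))) : ℝ × ℝ :=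
  (q.1.1 + q.2.1.1 + q.2.2.1,
    s.second₁ q.1 + s.second₂ q.2.1 (q.1.1 + q.2.1.1 + q.2.2.1 + q.2.2.2.2) + q.2.2.2.1)

/-- The energy used by Transmitter 1 in a block. -/
def energy₁ (q : (ℝ × ℝ) × ((ℝ × ℝ) × (ℝ × (ℝ × ℝ)))) : ℝ := q.1.1 ^ 2 + s.second₁ q.1 ^ 2

/-- The energy used by Transmitter 2 in a block. -/
def energy₂ (q : (ℝ × ℝ) × ((ℝ × ℝ) × (ℝ × (ℝ × ℝ)))) : ℝ :=
  q.2.1.1 ^ 2 + s.second₂ q.2.1 (q.1.1 + q.2.1.1 + q.2.2.1 + q.2.2.2.2) ^ 2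

/-- What remains of the second output given all symbols and the first output: the noise
`z₂ + κ w₁`. -/
def residual (q : (ℝ × ℝ) × ((ℝ × ℝ) × (ℝ × ℝ))) : ℝ :=
  q.2.2.2 - s.second₁ q.1 - s.second₂ q.2.1 q.2.2.1

/-- The variance of the residual noise. -/
def residualVar : ℝ := N + s.κ ^ 2 * σsq

/-- The variance of the second output; the summand `2 α κ Q₁` is the gain due to feedback. -/
def outputVar : ℝ := s.Q₁ + s.Q₂ + N + 2 * s.α * s.κ * s.Q₁

/-- The joint law of the symbols of both transmitters and the noise of a block. -/
noncomputable abbrev blockLaw : Measure ((ℝ × ℝ) × ((ℝ × ℝ) × (ℝ × (ℝ × ℝ)))) :=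
  (symbolLaw s.Q₁).prod ((symbolLaw s.Q₂).prod (blockNoiseLaw N σsq))

/-- The information density between the symbols of Transmitter 1 and the outputs, given the symbols
of Transmitter 2. -/
noncomputable def info₁ (q : (ℝ × ℝ) × ((ℝ × ℝ) × (ℝ × ℝ))) : ℝ :=
  logDensity N (q.2.2.1 - q.1.1 - q.2.1.1) - logDensity (N + s.Q₁) (q.2.2.1 - q.2.1.1)
    + (logDensity s.residualVar (s.residual q)
      - logDensity (s.residualVar + s.α' ^ 2 * s.Q₁) (s.residual q + s.α' * q.1.2))

/-- The information density between the symbols of Transmitter 2 and the outputs, given the symbols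
of Transmitter 1. -/
noncomputable def info₂ (q : (ℝ × ℝ) × ((ℝ × ℝ) × (ℝ × ℝ))) : ℝ :=
  logDensity N (q.2.2.1 - q.1.1 - q.2.1.1) - logDensity (N + s.Q₂) (q.2.2.1 - q.1.1)
    + (logDensity s.residualVar (s.residual q)
      - logDensity (s.residualVar + s.γ ^ 2 * s.Q₂) (s.residual q + s.γ * q.2.1.2))

/-- The information density between the symbols of both transmitters and the outputs. -/
noncomputable def info (q : (ℝ × ℝ) × ((ℝ × ℝ) × (ℝ × ℝ))) : ℝ :=
  logDensity N (q.2.2.1 - q.1.1 - q.2.1.1) - logDensity (N + s.Q₂ + s.Q₁) q.2.2.1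
    + (logDensity s.residualVar (s.residual q) - logDensity s.outputVar q.2.2.2)

theorem measurable_channel : Measurable s.channel := by
  unfold channel second₁ second₂; fun_prop

theorem measurable_energy₁ : Measurable s.energy₁ := by
  unfold energy₁ second₁; fun_prop

theorem measurable_energy₂ : Measurable s.energy₂ := by
  unfold energy₂ second₂; fun_prop

theorem measurable_info₁ : Measurable s.info₁ := by
  unfold info₁ residual second₁ second₂ logDensity; fun_prop

theorem measurable_info₂ : Measurable s.info₂ := by
  unfold info₂ residual second₁ second₂ logDensity; fun_prop

theorem measurable_info : Measurable s.info := by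
  unfold info residual second₁ second₂ logDensity; fun_prop

theorem outputVar_eq : s.outputVar = (s.α + s.κ) ^ 2 * s.Q₁ + s.α' ^ 2 * s.Q₁
    + (s.β ^ 2 + s.γ ^ 2) * s.Q₂ + s.κ ^ 2 * (N + σsq) + N := by
  unfold outputVar
  linear_combination -s.Q₁ * s.sq_add_sq - s.power_balance

theorem centered_linear (c₁ c₂ c₃ c₄ c₅ c₆ c₇ : ℝ) : Centered s.blockLaw
    (fun q => (c₁ * q.1.1 + c₂ * q.1.2) + ((c₃ * q.2.1.1 + c₄ * q.2.1.2)
      + (c₅ * q.2.2.1 + (c₆ * q.2.2.2.1 + c₇ * q.2.2.2.2))))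
    ((c₁ ^ 2 * s.Q₁ + c₂ ^ 2 * s.Q₁) + ((c₃ ^ 2 * s.Q₂ + c₄ ^ 2 * s.Q₂)
      + (c₅ ^ 2 * N + (c₆ ^ 2 * N + c₇ ^ 2 * σsq)))) :=
  have h := Centered.gaussianReal
  (((h s.Q₁).const_mul c₁).prod ((h s.Q₁).const_mul c₂)).prod
    ((((h s.Q₂).const_mul c₃).prod ((h s.Q₂).const_mul c₄)).prod
      (((h N).const_mul c₅).prod (((h N).const_mul c₆).prod ((h σsq).const_mul c₇))))

theorem centered_symbol₁ : Centered s.blockLaw (fun q => q.1.1) s.Q₁ :=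
  (s.centered_linear 1 0 0 0 0 0 0).congr (fun q => by ring) (by ring)

theorem centered_symbol₂ : Centered s.blockLaw (fun q => q.2.1.1) s.Q₂ :=
  (s.centered_linear 0 0 1 0 0 0 0).congr (fun q => by ring) (by ring)

theorem centered_second₁ : Centered s.blockLaw (fun q => s.second₁ q.1) s.Q₁ :=
  (s.centered_linear s.α s.α' 0 0 0 0 0).congr (fun q => by simp only [second₁]; ring)
    (by linear_combination s.Q₁ * s.sq_add_sq)

theorem centered_second₂ : Centered s.blockLaw
    (fun q => s.second₂ q.2.1 (q.1.1 + q.2.1.1 + q.2.2.1 + q.2.2.2.2)) s.Q₂ :=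
  (s.centered_linear s.κ 0 (-s.β) s.γ s.κ 0 s.κ).congr (fun q => by simp only [second₂]; ring)
    (by linear_combination s.power_balance)

theorem integrable_energy₁ : Integrable s.energy₁ s.blockLaw :=
  s.centered_symbol₁.integrable_sq.add s.centered_second₁.integrable_sq

theorem integrable_energy₂ : Integrable s.energy₂ s.blockLaw :=
  s.centered_symbol₂.integrable_sq.add s.centered_second₂.integrable_sq

theorem integral_energy₁ : ∫ q, s.energy₁ q ∂s.blockLaw = 2 * s.Q₁ := by
  unfold energy₁
  rw [integral_add s.centered_symbol₁.integrable_sq s.centered_second₁.integrable_sq,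
    s.centered_symbol₁.second, s.centered_second₁.second, two_mul]

theorem integral_energy₂ : ∫ q, s.energy₂ q ∂s.blockLaw = 2 * s.Q₂ := by
  unfold energy₂
  rw [integral_add s.centered_symbol₂.integrable_sq s.centered_second₂.integrable_sq,
    s.centered_symbol₂.second, s.centered_second₂.second, two_mul]

theorem centered_noise : Centered s.blockLaw (fun q => (s.channel q).1 - q.1.1 - q.2.1.1) N :=
  (s.centered_linear 0 0 0 0 1 0 0).congr (fun q => by simp only [channel]; ring) (by ring)

theorem centered_output_sub₂ : Centered s.blockLaw (fun q => (s.channel q).1 - q.2.1.1)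
    (N + s.Q₁) :=
  (s.centered_linear 1 0 0 0 1 0 0).congr (fun q => by simp only [channel]; ring) (by ring)

theorem centered_output_sub₁ : Centered s.blockLaw (fun q => (s.channel q).1 - q.1.1)
    (N + s.Q₂) :=
  (s.centered_linear 0 0 1 0 1 0 0).congr (fun q => by simp only [channel]; ring) (by ring)

theorem centered_fst_output : Centered s.blockLaw (fun q => (s.channel q).1) (N + s.Q₂ + s.Q₁) :=
  (s.centered_linear 1 0 1 0 1 0 0).congr (fun q => by simp only [channel]; ring) (by ring)

theorem centered_snd_output : Centered s.blockLaw (fun q => (s.channel q).2) s.outputVar :=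
  (s.centered_linear (s.α + s.κ) s.α' (-s.β) s.γ s.κ 1 s.κ).congr
    (fun q => by simp only [channel, second₁, second₂]; ring) (by rw [outputVar_eq]; ring)

theorem centered_residual : Centered s.blockLaw
    (fun q => s.residual (q.1, q.2.1, s.channel q)) s.residualVar :=
  (s.centered_linear 0 0 0 0 0 1 s.κ).congr
    (fun q => by simp only [channel, residual, second₁, second₂]; ring)
    (by simp only [residualVar]; ring)

theorem centered_residual_add₁ : Centered s.blockLaw
    (fun q => s.residual (q.1, q.2.1, s.channel q) + s.α' * q.1.2)
    (s.residualVar + s.α' ^ 2 * s.Q₁) :=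
  (s.centered_linear 0 s.α' 0 0 0 1 s.κ).congr
    (fun q => by simp only [channel, residual, second₁, second₂]; ring)
    (by simp only [residualVar]; ring)

theorem centered_residual_add₂ : Centered s.blockLaw
    (fun q => s.residual (q.1, q.2.1, s.channel q) + s.γ * q.2.1.2)
    (s.residualVar + s.γ ^ 2 * s.Q₂) :=
  (s.centered_linear 0 0 0 s.γ 0 1 s.κ).congr
    (fun q => by simp only [channel, residual, second₁, second₂]; ring)
    (by simp only [residualVar]; ring)

variable (hN : 0 < N)
include hN

theorem residualVar_pos : 0 < s.residualVar := by
  have : (0 : ℝ) < N := hN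
  unfold residualVar; positivity

theorem outputVar_pos : 0 < s.outputVar := by
  have : (0 : ℝ) < N := hN
  rw [outputVar_eq]; positivity

theorem lintegral_exp_info₁ (b y : ℝ × ℝ) :
    ∫⁻ a, ENNReal.ofReal (Real.exp (s.info₁ (a, b, y))) ∂symbolLaw s.Q₁ = 1 := by
  have h := lintegral_gaussianReal_prod_conv_sub (W := N) (s.residualVar_pos hN) s.Q₁_pos hN
    (u := fun a₁ => y.2 - s.α * a₁ - s.second₂ b y.1) (by fun_prop) s.α' (y.1 - b.1)
    (-logDensity (N + s.Q₁) (y.1 - b.1))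
  rw [neg_add_cancel, Real.exp_zero, ENNReal.ofReal_one] at h
  rw [← h]
  refine lintegral_congr fun a => ?_
  have residual_eq : s.residual (a, b, y) = y.2 - s.α * a.1 - s.second₂ b y.1 - s.α' * a.2 := by
    simp only [residual, second₁]; ring
  rw [info₁, residual_eq, sub_add_cancel, sub_right_comm y.1, neg_add_eq_sub]

theorem lintegral_exp_info₂ (a y : ℝ × ℝ) :
    ∫⁻ b, ENNReal.ofReal (Real.exp (s.info₂ (a, b, y))) ∂symbolLaw s.Q₂ = 1 := by
  have h := lintegral_gaussianReal_prod_conv_sub (W := N) (s.residualVar_pos hN) s.Q₂_pos hN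
    (u := fun b₁ => y.2 - s.second₁ a - (-s.β * b₁ + s.κ * (y.1 - b₁))) (by fun_prop) s.γ
    (y.1 - a.1) (-logDensity (N + s.Q₂) (y.1 - a.1))
  rw [neg_add_cancel, Real.exp_zero, ENNReal.ofReal_one] at h
  rw [← h]
  refine lintegral_congr fun b => ?_
  have residual_eq : s.residual (a, b, y)
      = y.2 - s.second₁ a - (-s.β * b.1 + s.κ * (y.1 - b.1)) - s.γ * b.2 := by
    simp only [residual, second₂]; ring
  rw [info₂, residual_eq, sub_add_cancel, neg_add_eq_sub]

/-- The second output minus `κ` times the first contains `-(β + κ) b₁`, whose conditional mean given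
`b₁ + z₁` is `-D (b₁ + z₁)`, with `D = (β + κ) Q₂ / (N + Q₂)`. -/
theorem lintegral_exp_info_right (a y : ℝ × ℝ) {D V : ℝ}
    (hD : D = (s.β + s.κ) * s.Q₂ / (N + s.Q₂))
    (hV : V = s.residualVar + s.γ ^ 2 * s.Q₂ + (s.β + s.κ) ^ 2 * (s.Q₂ * N / (N + s.Q₂))) :
    ∫⁻ b, ENNReal.ofReal (Real.exp (s.info (a, b, y))) ∂symbolLaw s.Q₂
      = ENNReal.ofReal (Real.exp (-logDensity (N + s.Q₂ + s.Q₁) y.1 - logDensity s.outputVar y.2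
        + logDensity (N + s.Q₂) (y.1 - a.1)
        + logDensity V (y.2 - s.κ * y.1 + D * y.1 - (s.α + D) * a.1 - s.α' * a.2))) := by
  have h := lintegral_gaussianReal_prod_conv₂ (W := N) (s.residualVar_pos hN) s.Q₂_pos hN s.γ
    (-(s.β + s.κ)) (y.1 - a.1) (y.2 - s.second₁ a - s.κ * y.1)
    (-logDensity (N + s.Q₂ + s.Q₁) y.1 - logDensity s.outputVar y.2)
  rw [neg_sq, ← hV] at h
  convert h using 5 with b
  · have residual_eq : s.residual (a, b, y)
        = y.2 - s.second₁ a - s.κ * y.1 - (-(s.β + s.κ)) * b.1 - s.γ * b.2 := by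
      simp only [residual, second₂]; ring
    rw [info, residual_eq]
    ring
  · simp only [second₁, hD]
    ring

theorem lintegral_exp_info (y : ℝ × ℝ) :
    ∫⁻ q, ENNReal.ofReal (Real.exp (s.info (q.1, q.2, y)))
      ∂(symbolLaw s.Q₁).prod (symbolLaw s.Q₂) = 1 := by
  have hR := s.residualVar_pos hN
  have hQ₁ : (0 : ℝ) < s.Q₁ := s.Q₁_pos
  have hQ₂ : (0 : ℝ) < s.Q₂ := s.Q₂_pos
  have hβ : s.β = (s.α * s.Q₁ + s.κ * (s.Q₁ + N)) / s.Q₂ := by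
    field_simp; exact s.decorrelation
  obtain ⟨D, hD⟩ : ∃ D, D = (s.β + s.κ) * s.Q₂ / (N + s.Q₂) := ⟨_, rfl⟩
  obtain ⟨V, hV⟩ : ∃ V, V = s.residualVar + s.γ ^ 2 * s.Q₂
    + (s.β + s.κ) ^ 2 * (s.Q₂ * N / (N + s.Q₂)) := ⟨_, rfl⟩
  have variance_eq : V + s.α' ^ 2 * s.Q₁
      + (s.α + D) ^ 2 * (s.Q₁ * (N + s.Q₂) / (N + s.Q₂ + s.Q₁)) = s.outputVar := by
    rw [outputVar_eq, hV, hD, hβ, residualVar]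
    field_simp
    ring
  have center_eq : y.2 - s.κ * y.1 + D * y.1
      - (s.α + D) * (s.Q₁ * y.1 / (N + s.Q₂ + s.Q₁)) = y.2 := by
    rw [hD, hβ]
    field_simp
    ring
  have hm : Measurable fun q : (ℝ × ℝ) × (ℝ × ℝ) => s.info (q.1, q.2, y) :=
    s.measurable_info.comp (f := fun q : (ℝ × ℝ) × (ℝ × ℝ) => (q.1, q.2, y)) (by fun_prop)
  have h := lintegral_gaussianReal_prod_conv₂ (V := V) (W := N + s.Q₂) (by rw [hV]; positivity)
    s.Q₁_pos (by positivity) s.α' (s.α + D) y.1 (y.2 - s.κ * y.1 + D * y.1)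
    (-logDensity (N + s.Q₂ + s.Q₁) y.1 - logDensity s.outputVar y.2)
  rw [variance_eq, center_eq] at h
  rw [lintegral_prod _ hm.exp.ennreal_ofReal.aemeasurable]
  simp only [s.lintegral_exp_info_right hN _ y hD hV, h]
  rw [show ∀ u v : ℝ, -u - v + u + v = 0 from fun u v => by ring, Real.exp_zero,
    ENNReal.ofReal_one]

/-- The information densities of the scheme, as scores for a threshold decoder. -/
noncomputable def scores :
    DecodingScores (symbolLaw s.Q₁) (symbolLaw s.Q₂) (blockNoiseLaw N σsq) s.channel where
  score₁ := s.info₁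
  score₂ := s.info₂
  score := s.info
  measurable₁ := s.measurable_info₁
  measurable₂ := s.measurable_info₂
  measurable := s.measurable_info
  integrable₁ := (s.centered_noise.integrable_logDensity_sub s.centered_output_sub₂ _ _).add
    (s.centered_residual.integrable_logDensity_sub s.centered_residual_add₁ _ _)
  integrable₂ := (s.centered_noise.integrable_logDensity_sub s.centered_output_sub₁ _ _).add
    (s.centered_residual.integrable_logDensity_sub s.centered_residual_add₂ _ _)
  integrable := (s.centered_noise.integrable_logDensity_sub s.centered_fst_output _ _).add
    (s.centered_residual.integrable_logDensity_sub s.centered_snd_output _ _)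
  lintegral_exp₁_le b y := (s.lintegral_exp_info₁ hN b y).le
  lintegral_exp₂_le a y := (s.lintegral_exp_info₂ hN a y).le
  lintegral_exp_le y := (s.lintegral_exp_info hN y).le

theorem mean₁_scores : (s.scores hN).mean₁ = 1 / 2 * Real.log
    ((N + s.Q₁) * (s.residualVar + s.α' ^ 2 * s.Q₁) / (N * s.residualVar)) := by
  have hN' : (0 : ℝ) < N := hN
  have hR := s.residualVar_pos hN
  exact s.centered_noise.integral_logDensity_sub_add s.centered_output_sub₂ s.centered_residual
    s.centered_residual_add₁ hN' (by positivity) hR (by positivity)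

theorem mean₂_scores : (s.scores hN).mean₂ = 1 / 2 * Real.log
    ((N + s.Q₂) * (s.residualVar + s.γ ^ 2 * s.Q₂) / (N * s.residualVar)) := by
  have hN' : (0 : ℝ) < N := hN
  have hR := s.residualVar_pos hN
  exact s.centered_noise.integral_logDensity_sub_add s.centered_output_sub₁ s.centered_residual
    s.centered_residual_add₂ hN' (by positivity) hR (by positivity)

theorem mean_scores : (s.scores hN).mean = 1 / 2 * Real.log
    ((N + s.Q₂ + s.Q₁) * s.outputVar / (N * s.residualVar)) := by
  have hN' : (0 : ℝ) < N := hN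
  exact s.centered_noise.integral_logDensity_sub_add s.centered_fst_output s.centered_residual
    s.centered_snd_output hN' (by positivity) (s.residualVar_pos hN) (s.outputVar_pos hN)

end LinearScheme

/-! ### Choice of the parameters -/

/-- The value of `γ²` which gives the inputs of Transmitter 2 equal variances, when the noise
variances are `n` and `w`, the symbol variances `x` and `y`, and the outputs are uncorrelated. -/
noncomputable def freshFraction (n w x y α κ : ℝ) : ℝ :=
  1 - ((α * x + κ * (x + n)) / y) ^ 2 - κ ^ 2 * (x + n + w) / y

/-- The exponential of twice the sum of the mean information densities of the two transmitters. -/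
noncomputable def individualGain (n w x y α κ : ℝ) : ℝ :=
  (n + x) * (n + κ ^ 2 * w + (1 - α ^ 2) * x) / (n * (n + κ ^ 2 * w))
    * ((n + y) * (n + κ ^ 2 * w + freshFraction n w x y α κ * y) / (n * (n + κ ^ 2 * w)))

/-- The exponential of twice the mean joint information density. -/
noncomputable def jointGain (n w x y α κ : ℝ) : ℝ :=
  (n + y + x) * (x + y + n + 2 * α * κ * x) / (n * (n + κ ^ 2 * w))

section Continuity

variable {T : Type*} [TopologicalSpace T] {x y α κ : T → ℝ} {t : T} {n w : ℝ}
  (hx : ContinuousAt x t) (hy : ContinuousAt y t) (hα : ContinuousAt α t) (hκ : ContinuousAt κ t)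
include hx hy hα hκ

theorem continuousAt_freshFraction (hyt : y t ≠ 0) :
    ContinuousAt (fun t => freshFraction n w (x t) (y t) (α t) (κ t)) t := by
  unfold freshFraction
  fun_prop (disch := exact hyt)

theorem continuousAt_individualGain (hn : 0 < n) (hw : 0 ≤ w) (hyt : y t ≠ 0) :
    ContinuousAt (fun t => individualGain n w (x t) (y t) (α t) (κ t)) t := by
  have hfresh := continuousAt_freshFraction (n := n) (w := w) hx hy hα hκ hyt
  have hden : n * (n + κ t ^ 2 * w) ≠ 0 := by positivity
  unfold individualGain
  fun_prop (disch := exact hden)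

theorem continuousAt_jointGain (hn : 0 < n) (hw : 0 ≤ w) :
    ContinuousAt (fun t => jointGain n w (x t) (y t) (α t) (κ t)) t := by
  have hden : n * (n + κ t ^ 2 * w) ≠ 0 := by positivity
  unfold jointGain
  fun_prop (disch := exact hden)

end Continuity

section Gain

variable {n w x y : ℝ} (hn : 0 < n) (hw : 0 ≤ w) (hx : 0 < x) (hy : 0 < y)
include hn hx hy

theorem lt_individualGain_zero : (1 + (x + y) / n) ^ 2 < individualGain n w x y 0 0 := by
  have gap : (1 + (x + y) / n) ^ 2 + x * y * (x * y + 2 * n * (x + y + n)) / n ^ 4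
      = individualGain n w x y 0 0 := by
    simp only [individualGain, freshFraction, zero_mul, add_zero, zero_div, ne_eq,
      OfNat.ofNat_ne_zero, not_false_eq_true, zero_pow, sub_zero, one_mul]
    field_simp
    ring
  rw [← gap]
  exact lt_add_of_pos_right _ (by positivity)

include hw

/-- The gain `2 ε (c ε) x` in the variance of the second output is of first order in `c`, while the
loss `(c ε)² w` from the feedback noise is of second order. -/
theorem lt_jointGain {c ε : ℝ} (hc : 0 < c) (hcw : (x + y + n) * c * w < 2 * x * n) (hε : 0 < ε) :
    (1 + (x + y) / n) ^ 2 < jointGain n w x y ε (c * ε) := by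
  have gap : (1 + (x + y) / n) ^ 2 + (x + y + n) * c * ε ^ 2 * (2 * x * n - (x + y + n) * c * w)
      / (n ^ 2 * (n + (c * ε) ^ 2 * w)) = jointGain n w x y ε (c * ε) := by
    unfold jointGain
    field_simp
    ring
  rw [← sub_pos] at hcw
  rw [← gap]
  exact lt_add_of_pos_right _ (by positivity)

theorem exists_gain : ∃ α κ, α ^ 2 ≤ 1 ∧ 0 < freshFraction n w x y α κ ∧
    (1 + (x + y) / n) ^ 2 < individualGain n w x y α κ ∧
    (1 + (x + y) / n) ^ 2 < jointGain n w x y α κ := by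
  obtain ⟨c, hc, hcw⟩ : ∃ c, 0 < c ∧ (x + y + n) * c * w < 2 * x * n := by
    refine ⟨x * n / ((x + y + n) * (w + 1)), by positivity, ?_⟩
    have e : (x + y + n) * (x * n / ((x + y + n) * (w + 1))) * w = x * n * (w / (w + 1)) := by
      field_simp
    have hw1 : w / (w + 1) < 1 := (div_lt_one (by positivity)).2 (lt_add_one w)
    rw [e]
    nlinarith [mul_pos hx hn]
  have hκ : ContinuousAt (fun ε : ℝ => c * ε) 0 := by fun_prop
  have fresh_pos : ∀ᶠ ε in 𝓝 (0 : ℝ), 0 < freshFraction n w x y ε (c * ε) :=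
    (continuousAt_freshFraction continuousAt_const continuousAt_const continuousAt_id hκ
      hy.ne').eventually (lt_mem_nhds (by simp [freshFraction]))
  have individual_gt : ∀ᶠ ε in 𝓝 (0 : ℝ),
      (1 + (x + y) / n) ^ 2 < individualGain n w x y ε (c * ε) :=
    (continuousAt_individualGain continuousAt_const continuousAt_const continuousAt_id hκ hn hw
      hy.ne').eventually (lt_mem_nhds
        (by simpa only [id, mul_zero] using lt_individualGain_zero hn hx hy))
  obtain ⟨ε, hε, fresh, individual, hε1⟩ :=
    (fresh_pos.and (individual_gt.and (gt_mem_nhds zero_lt_one))).exists_gt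
  exact ⟨ε, c * ε, pow_le_one₀ hε.le hε1.le, fresh, individual,
    lt_jointGain hn hw hx hy hc hcw hε⟩

theorem exists_gain_of_lt : ∃ x' y' α κ, 0 < x' ∧ x' < x ∧ 0 < y' ∧ y' < y ∧ α ^ 2 ≤ 1 ∧
    0 < freshFraction n w x' y' α κ ∧ (1 + (x + y) / n) ^ 2 < individualGain n w x' y' α κ ∧
    (1 + (x + y) / n) ^ 2 < jointGain n w x' y' α κ := by
  obtain ⟨α, κ, hα, fresh, individual, joint⟩ := exists_gain hn hw hx hy
  have hcx : ContinuousAt (fun t : ℝ => t * x) 1 := by fun_prop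
  have hcy : ContinuousAt (fun t : ℝ => t * y) 1 := by fun_prop
  rw [← one_mul x, ← one_mul y] at fresh
  have fresh_pos := (continuousAt_freshFraction hcx hcy continuousAt_const continuousAt_const
    (by positivity)).eventually (lt_mem_nhds fresh)
  have individual_gt := (continuousAt_individualGain hcx hcy continuousAt_const continuousAt_const
    hn hw (by positivity)).eventually
      (lt_mem_nhds (by simpa only [one_mul] using individual))
  have joint_gt := (continuousAt_jointGain hcx hcy continuousAt_const continuousAt_const
    hn hw).eventually (lt_mem_nhds (by simpa only [one_mul] using joint))
  obtain ⟨t, ht1, fresh, individual, joint, ht0⟩ :=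
    (fresh_pos.and (individual_gt.and (joint_gt.and (lt_mem_nhds zero_lt_one)))).exists_lt
  exact ⟨t * x, t * y, α, κ, mul_pos ht0 hx, mul_lt_of_lt_one_left hx ht1, mul_pos ht0 hy,
    mul_lt_of_lt_one_left hy ht1, hα, fresh, individual, joint⟩

end Gain

namespace LinearScheme

variable {N σsq Q₁ Q₂ : ℝ≥0} {α κ : ℝ}

/-- The linear scheme determined by the correlation `α` and the weight `κ` of the feedback. -/
noncomputable def ofFeedback (hQ₁ : 0 < Q₁) (hQ₂ : 0 < Q₂) (hα : α ^ 2 ≤ 1)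
    (hκ : 0 ≤ freshFraction N σsq Q₁ Q₂ α κ) : LinearScheme N σsq where
  Q₁ := Q₁
  Q₂ := Q₂
  α := α
  α' := √(1 - α ^ 2)
  β := (α * Q₁ + κ * (Q₁ + N)) / Q₂
  γ := √(freshFraction N σsq Q₁ Q₂ α κ)
  κ := κ
  Q₁_pos := hQ₁
  Q₂_pos := hQ₂
  sq_add_sq := by rw [Real.sq_sqrt (sub_nonneg.2 hα)]; ring
  power_balance := by
    have : (Q₂ : ℝ) ≠ 0 := by positivity
    rw [Real.sq_sqrt hκ, freshFraction]
    field_simp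
    ring
  decorrelation := div_mul_cancel₀ _ (by positivity)

variable {hQ₁ : 0 < Q₁} {hQ₂ : 0 < Q₂} {hα : α ^ 2 ≤ 1}
  {hκ : 0 ≤ freshFraction N σsq Q₁ Q₂ α κ}

theorem mean₁_add_mean₂_ofFeedback (hN : 0 < N) :
    ((ofFeedback hQ₁ hQ₂ hα hκ).scores hN).mean₁ + ((ofFeedback hQ₁ hQ₂ hα hκ).scores hN).mean₂
      = 1 / 2 * Real.log (individualGain N σsq Q₁ Q₂ α κ) := by
  have hα' := sub_nonneg.2 hα
  rw [mean₁_scores, mean₂_scores, individualGain, Real.log_mul (by positivity) (by positivity)]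
  simp only [ofFeedback, residualVar, Real.sq_sqrt hα', Real.sq_sqrt hκ]
  ring

theorem mean_ofFeedback (hN : 0 < N) : ((ofFeedback hQ₁ hQ₂ hα hκ).scores hN).mean
    = 1 / 2 * Real.log (jointGain N σsq Q₁ Q₂ α κ) := by
  rw [mean_scores, jointGain]
  simp only [ofFeedback, residualVar, outputVar]

theorem exists_mean_gt {P₁ P₂ : ℝ≥0} (hP₁ : 0 < P₁) (hP₂ : 0 < P₂) (hN : 0 < N) (σsq : ℝ≥0) :
    ∃ s : LinearScheme N σsq, s.Q₁ < P₁ ∧ s.Q₂ < P₂ ∧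
      Real.log (1 + ((P₁ : ℝ) + P₂) / N) < (s.scores hN).mean₁ + (s.scores hN).mean₂ ∧
      Real.log (1 + ((P₁ : ℝ) + P₂) / N) < (s.scores hN).mean := by
  obtain ⟨x, y, α, κ, hx, hxP, hy, hyP, hα, fresh, individual, joint⟩ :=
    exists_gain_of_lt (n := N) (w := σsq) hN σsq.coe_nonneg (NNReal.coe_pos.2 hP₁)
      (NNReal.coe_pos.2 hP₂)
  lift x to ℝ≥0 using hx.le
  lift y to ℝ≥0 using hy.le
  have log_lt : ∀ {g : ℝ}, (1 + ((P₁ : ℝ) + P₂) / N) ^ 2 < g →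
      Real.log (1 + ((P₁ : ℝ) + P₂) / N) < 1 / 2 * Real.log g := fun h => by
    have := Real.log_lt_log (by positivity) h
    rw [Real.log_pow] at this
    push_cast at this
    linarith
  refine ⟨ofFeedback (NNReal.coe_pos.1 hx) (NNReal.coe_pos.1 hy) hα fresh.le,
    NNReal.coe_lt_coe.1 hxP, NNReal.coe_lt_coe.1 hyP,
    (log_lt individual).trans_eq (mean₁_add_mean₂_ofFeedback hN).symm,
    (log_lt joint).trans_eq (mean_ofFeedback hN).symm⟩

end LinearScheme

/-! ### From block codes to feedback codes -/

/-- The first channel use of block `j`. -/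
def firstUse {n : ℕ} (j : Fin (n / 2)) : Fin n := ⟨2 * j, by omega⟩

/-- The second channel use of block `j`. -/
def secondUse {n : ℕ} (j : Fin (n / 2)) : Fin n := ⟨2 * j + 1, by omega⟩

theorem injective_elim_firstUse_secondUse (n : ℕ) :
    Function.Injective (Sum.elim (firstUse (n := n)) secondUse) := by
  rintro (i | i) (j | j) h <;> simp only [Sum.elim_inl, Sum.elim_inr, firstUse, secondUse,
    Fin.mk.injEq] at h <;> simp only [Sum.inl.injEq, Sum.inr.injEq, reduceCtorEq, Fin.ext_iff] <;>
    omega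

theorem sum_eq_sum_blocks {M : Type*} [AddCommMonoid M] {n : ℕ} {g : Fin n → M}
    (hg : ∀ t : Fin n, n / 2 ≤ t / 2 → g t = 0) :
    ∑ t, g t = ∑ j, (g (firstUse j) + g (secondUse j)) := by
  have outside : ∀ t ∉ Set.range (Sum.elim (firstUse (n := n)) secondUse), g t = 0 := by
    refine fun t ht => hg t (not_lt.1 fun hlt => ht ?_)
    rcases Nat.even_or_odd' t.1 with ⟨j, hj | hj⟩
    · exact ⟨Sum.inl ⟨j, by omega⟩, Fin.ext hj.symm⟩
    · exact ⟨Sum.inr ⟨j, by omega⟩, Fin.ext hj.symm⟩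
  rw [← Fintype.sum_of_injective _ (injective_elim_firstUse_secondUse n) _ g outside fun _ => rfl,
    Fintype.sum_sum_type, ← Finset.sum_add_distrib]
  rfl

theorem sum_lintegral_le_lintegral_sum {Ω ι : Type*} [MeasurableSpace Ω] (ρ : Measure Ω)
    (s : Finset ι) (f : ι → Ω → ℝ≥0∞) :
    ∑ i ∈ s, ∫⁻ ω, f i ω ∂ρ ≤ ∫⁻ ω, ∑ i ∈ s, f i ω ∂ρ := by
  classical
  induction s using Finset.induction_on with
  | empty => simp
  | insert i s hi ih =>
    simp only [Finset.sum_insert hi]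
    exact (add_le_add le_rfl ih).trans (le_lintegral_add _ _)

theorem powerConstraint_of_lintegral_sum_le {Ω : Type*} [MeasurableSpace Ω] {ρ : Measure Ω} {n : ℕ}
    (hn : 0 < n) {X : Fin n → Ω → ℝ} {P : ℝ≥0}
    (h : ∫⁻ ω, ENNReal.ofReal (∑ t, X t ω ^ 2) ∂ρ ≤ n * P) : PowerConstraint ρ X P := by
  simp only [ENNReal.ofReal_sum_of_nonneg fun t _ => sq_nonneg (X t _)] at h
  exact (powerConstraint_iff_sum_lintegral_le hn P).2
    ((sum_lintegral_le_lintegral_sum ρ _ _).trans h)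

/-- The noise of the blocks, extracted from the noise of the channel uses. -/
def blockNoise {n : ℕ} (e : (Fin n → ℝ) × (Fin n → ℝ)) (j : Fin (n / 2)) : ℝ × (ℝ × ℝ) :=
  (e.1 (firstUse j), e.1 (secondUse j), e.2 (firstUse j))

theorem measurePreserving_blockNoise (n : ℕ) (N σsq : ℝ≥0) :
    MeasurePreserving (blockNoise (n := n)) ((noiseLaw n N).prod (noiseLaw n σsq))
      (Measure.pi fun _ => blockNoiseLaw N σsq) := by
  have hinj := injective_elim_firstUse_secondUse n
  have feedback : MeasurePreserving (fun (w : Fin n → ℝ) (j : Fin (n / 2)) => w (firstUse j))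
      (noiseLaw n σsq) (Measure.pi fun _ => gaussianReal 0 σsq) :=
    ⟨by fun_prop, map_pi_precomp _ (hinj.comp Sum.inl_injective)⟩
  have receiver : MeasurePreserving (fun z : Fin n → ℝ =>
        ((fun j : Fin (n / 2) => z (firstUse j)), fun j : Fin (n / 2) => z (secondUse j)))
      (noiseLaw n N) ((Measure.pi fun _ => gaussianReal 0 N).prod
        (Measure.pi fun _ => gaussianReal 0 N)) :=
    (measurePreserving_sumPiEquivProdPi
      (fun _ : Fin (n / 2) ⊕ Fin (n / 2) => gaussianReal 0 N)).comp
      (⟨by fun_prop, map_pi_precomp (gaussianReal 0 N) hinj⟩ :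
        MeasurePreserving (fun (z : Fin n → ℝ) i => z (Sum.elim firstUse secondUse i))
          (noiseLaw n N) (Measure.pi fun _ => gaussianReal 0 N))
  exact (measurePreserving_zip₃ (gaussianReal 0 N) (gaussianReal 0 N) (gaussianReal 0 σsq)
    (Fin (n / 2))).comp ((measurePreserving_prodAssoc _ _ _).comp (receiver.prod feedback))

namespace LinearScheme

variable {N σsq : ℝ≥0} (s : LinearScheme N σsq) {n : ℕ}
  (c : BlockCode (n / 2) (ℝ × ℝ) (ℝ × ℝ) (ℝ × ℝ))

/-- The feedback code that applies the linear scheme to pairs of channel uses; the last use is idle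
when the blocklength is odd. -/
noncomputable def code : PartialFeedbackCode n where
  size₁ := c.size₁
  size₂ := c.size₂
  size₁_pos := c.size₁_pos
  size₂_pos := c.size₂_pos
  enc₁ t m := if h : t.val / 2 < n / 2 then
    (if t.val % 2 = 0 then (c.word₁ m ⟨t / 2, h⟩).1 else s.second₁ (c.word₁ m ⟨t / 2, h⟩)) else 0
  enc₂ t m v := if h : t.val / 2 < n / 2 then
    (if h' : t.val % 2 = 0 then (c.word₂ m ⟨t / 2, h⟩).1
      else s.second₂ (c.word₂ m ⟨t / 2, h⟩) (v ⟨t - 1, by omega⟩)) else 0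
  measurable_enc₂ t m := by
    unfold second₂
    split_ifs <;> fun_prop
  dec y := c.dec fun j => (y (firstUse j), y (secondUse j))
  measurable_dec := c.measurable_dec.comp (by fun_prop)

variable {c}

/-- The outcome for the block code that belongs to an outcome for the feedback code. -/
def blockOutcome (ω : (s.code c).Outcome) : c.Outcome (ℝ × (ℝ × ℝ)) := (ω.1, blockNoise ω.2)

variable (ω : (s.code c).Outcome)

theorem code_input₁_firstUse (j : Fin (n / 2)) :
    (s.code c).input₁ (firstUse j) ω = (c.word₁ ω.1.1 j).1 := by
  have hj : 2 * j.1 / 2 = j.1 := by omega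
  simp [code, PartialFeedbackCode.input₁, firstUse, hj]

theorem code_input₁_secondUse (j : Fin (n / 2)) :
    (s.code c).input₁ (secondUse j) ω = s.second₁ (c.word₁ ω.1.1 j) := by
  have hj : (2 * j.1 + 1) / 2 = j.1 := by omega
  have hj' : (2 * j.1 + 1) % 2 = 1 := by omega
  simp [code, PartialFeedbackCode.input₁, secondUse, hj, hj']

theorem code_input₂_firstUse (j : Fin (n / 2)) :
    (s.code c).input₂ (firstUse j) ω = (c.word₂ ω.1.2 j).1 := by
  have hj : 2 * j.1 / 2 = j.1 := by omega
  simp [code, PartialFeedbackCode.input₂, firstUse, hj]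

theorem code_input₂_secondUse (j : Fin (n / 2)) :
    (s.code c).input₂ (secondUse j) ω
      = s.second₂ (c.word₂ ω.1.2 j) ((s.code c).feedback ω (firstUse j)) := by
  have hj : (2 * j.1 + 1) / 2 = j.1 := by omega
  have hj' : (2 * j.1 + 1) % 2 = 1 := by omega
  simp [code, PartialFeedbackCode.input₂, secondUse, hj, hj', firstUse]

theorem code_output_firstUse (j : Fin (n / 2)) :
    (s.code c).output ω (firstUse j) = (s.channel (c.letters (s.blockOutcome ω) j)).1 := by
  rw [PartialFeedbackCode.output_eq, code_input₁_firstUse, code_input₂_firstUse]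
  rfl

theorem code_output_secondUse (j : Fin (n / 2)) :
    (s.code c).output ω (secondUse j) = (s.channel (c.letters (s.blockOutcome ω) j)).2 := by
  rw [PartialFeedbackCode.output_eq, code_input₁_secondUse, code_input₂_secondUse,
    PartialFeedbackCode.feedback, code_output_firstUse]
  rfl

theorem code_dec_output : (s.code c).dec ((s.code c).output ω)
    = c.dec fun j => s.channel (c.letters (s.blockOutcome ω) j) :=
  congrArg c.dec (funext fun j =>
    Prod.ext (s.code_output_firstUse ω j) (s.code_output_secondUse ω j))

theorem sum_code_input₁_sq :
    ∑ t, (s.code c).input₁ t ω ^ 2 = ∑ j, s.energy₁ (c.letters (s.blockOutcome ω) j) := by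
  rw [sum_eq_sum_blocks fun t ht => ?_]
  · simp only [code_input₁_firstUse, code_input₁_secondUse]
    rfl
  · simp [code, PartialFeedbackCode.input₁, not_lt.2 ht]

theorem sum_code_input₂_sq :
    ∑ t, (s.code c).input₂ t ω ^ 2 = ∑ j, s.energy₂ (c.letters (s.blockOutcome ω) j) := by
  rw [sum_eq_sum_blocks fun t ht => ?_]
  · simp only [code_input₂_firstUse, code_input₂_secondUse, PartialFeedbackCode.feedback,
      code_output_firstUse]
    rfl
  · simp [code, PartialFeedbackCode.input₂, not_lt.2 ht]

variable (c)

theorem measurePreserving_blockOutcome :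
    MeasurePreserving (s.blockOutcome (c := c)) ((s.code c).law N σsq)
      (c.law (blockNoiseLaw N σsq)) := by
  have := isProbabilityMeasure_messageLaw c.size₁_pos c.size₂_pos
  exact (MeasurePreserving.id (messageLaw c.size₁ c.size₂)).prod
    (measurePreserving_blockNoise n N σsq)

theorem errorProb_code :
    (s.code c).errorProb N σsq = c.errorProb s.channel (blockNoiseLaw N σsq) := by
  have hch := s.measurable_channel
  have hlet := c.measurable_letters (E := ℝ × (ℝ × ℝ))
  have hdec := c.measurable_dec
  have hE : MeasurableSet {ω : c.Outcome (ℝ × (ℝ × ℝ)) |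
      c.dec (fun j => s.channel (c.letters ω j)) ≠ ω.1} :=
    (measurableSet_eq_fun (by fun_prop) measurable_fst).compl
  rw [BlockCode.errorProb, ← (s.measurePreserving_blockOutcome c).measure_preimage
    hE.nullMeasurableSet, PartialFeedbackCode.errorProb]
  simp only [code_dec_output]
  rfl

theorem admissible_code (hn : 0 < n) {P₁ P₂ : ℝ≥0}
    (h₁ : ∫⁻ ω, ENNReal.ofReal (∑ j, s.energy₁ (c.letters ω j)) ∂c.law (blockNoiseLaw N σsq)
      ≤ n * P₁)
    (h₂ : ∫⁻ ω, ENNReal.ofReal (∑ j, s.energy₂ (c.letters ω j)) ∂c.law (blockNoiseLaw N σsq)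
      ≤ n * P₂) :
    (s.code c).Admissible P₁ P₂ N σsq := by
  have hmp := s.measurePreserving_blockOutcome c
  have hE₁ := s.measurable_energy₁
  have hE₂ := s.measurable_energy₂
  have hlet := c.measurable_letters (E := ℝ × (ℝ × ℝ))
  constructor
  · refine powerConstraint_of_lintegral_sum_le hn ?_
    rw [← hmp.lintegral_comp (by fun_prop)] at h₁
    simpa only [sum_code_input₁_sq] using h₁
  · refine powerConstraint_of_lintegral_sum_le hn ?_
    rw [← hmp.lintegral_comp (by fun_prop)] at h₂
    simpa only [sum_code_input₂_sq] using h₂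

end LinearScheme

/-! ### The sum rate with feedback -/

theorem exists_rates {I₁ I₂ I L : ℝ} (h₁ : 0 < I₁) (h₂ : 0 < I₂) (hL : 0 ≤ L) (h : L < I)
    (h₁₂ : L < I₁ + I₂) :
    ∃ R₁ R₂, 0 ≤ R₁ ∧ 0 ≤ R₂ ∧ R₁ < I₁ ∧ R₂ < I₂ ∧ R₁ + R₂ < I ∧ L < R₁ + R₂ := by
  obtain ⟨T, hLT, hT⟩ := exists_between (lt_min h h₁₂)
  have hT₁ := hT.trans_le (min_le_left _ _)
  have hT₂ := hT.trans_le (min_le_right _ _)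
  have hs : 0 < I₁ + I₂ := by positivity
  have hT0 : 0 ≤ T := hL.trans hLT.le
  have hr : T / (I₁ + I₂) < 1 := (div_lt_one hs).2 hT₂
  have hsum : I₁ * (T / (I₁ + I₂)) + I₂ * (T / (I₁ + I₂)) = T := by field_simp
  exact ⟨I₁ * (T / (I₁ + I₂)), I₂ * (T / (I₁ + I₂)), by positivity, by positivity,
    mul_lt_of_lt_one_right h₁ hr, mul_lt_of_lt_one_right h₂ hr, hsum.trans_lt hT₁,
    hLT.trans_eq hsum.symm⟩

theorem eventually_rate_lt {R δ : ℝ} (hR : 0 ≤ R) (hδ : 0 < δ) {M : ℕ → ℕ}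
    (hM : ∀ k : ℕ, Real.exp (k * R) ≤ M k) :
    ∀ᶠ n : ℕ in atTop, R / 2 - δ < 1 / n * Real.log (M (n / 2)) := by
  have hlim : Tendsto (fun n : ℕ => R / n) atTop (𝓝 0) := tendsto_const_div_atTop_nhds_zero_nat R
  filter_upwards [hlim.eventually (gt_mem_nhds hδ), eventually_gt_atTop 0] with n hn hn0
  have hn' : (0 : ℝ) < n := by exact_mod_cast hn0
  have hlog : ((n / 2 : ℕ) : ℝ) * R ≤ Real.log (M (n / 2)) := by
    rw [Real.le_log_iff_exp_le ((Real.exp_pos _).trans_le (hM _))]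
    exact hM _
  have hk : (n : ℝ) ≤ 2 * ((n / 2 : ℕ) : ℝ) + 1 := by
    exact_mod_cast (by omega : n ≤ 2 * (n / 2) + 1)
  rw [div_lt_iff₀ hn'] at hn
  rw [one_div_mul_eq_div, lt_div_iff₀ hn']
  nlinarith

theorem eventually_lintegral_ofReal_sum_le {X : Type*} [MeasurableSpace X] {ρ : Measure X}
    {g : X → ℝ} {Q P : ℝ≥0} (hg : ∫ y, g y ∂ρ = 2 * Q) (hQP : Q < P) {Ω : ℕ → Type*}
    [∀ k, MeasurableSpace (Ω k)] {π : ∀ k, Measure (Ω k)} [∀ k, IsProbabilityMeasure (π k)]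
    {x : ∀ k, Ω k → Fin k → X}
    (h : Tendsto (fun k => ∫⁻ ω, averageDev ρ g (x k ω) ∂π k) atTop (𝓝 0)) :
    ∀ᶠ n : ℕ in atTop,
      ∫⁻ ω, ENNReal.ofReal (∑ t, g (x (n / 2) ω t)) ∂π (n / 2) ≤ n * P := by
  have hgap : ∫ y, g y ∂ρ < 2 * P := by
    rw [hg]
    exact mul_lt_mul_of_pos_left (NNReal.coe_lt_coe.2 hQP) two_pos
  have hdev := (Nat.tendsto_div_const_atTop two_ne_zero).eventually
    (h.eventually (gt_mem_nhds (ENNReal.ofReal_pos.2 (sub_pos.2 hgap))))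
  filter_upwards [hdev] with n hn
  refine (lintegral_ofReal_sum_le (by rw [hg]; positivity) hgap.le hn.le).trans ?_
  rw [ENNReal.ofReal_mul two_pos.le, ENNReal.ofReal_coe_nnreal, ENNReal.ofReal_ofNat, ← mul_assoc]
  gcongr
  exact_mod_cast Nat.div_mul_le_self n 2

namespace LinearScheme

variable {P₁ P₂ N σsq : ℝ≥0} (s : LinearScheme N σsq)

section Scores

variable (hN : 0 < N)
include hN

theorem mean₁_scores_pos : 0 < (s.scores hN).mean₁ := by
  have hQ : (0 : ℝ) < s.Q₁ := s.Q₁_pos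
  have hR := s.residualVar_pos hN
  rw [mean₁_scores]
  refine mul_pos one_half_pos (Real.log_pos ((one_lt_div (by positivity)).2 ?_))
  exact mul_lt_mul (by linarith) (le_add_of_nonneg_right (by positivity)) hR (by positivity)

theorem mean₂_scores_pos : 0 < (s.scores hN).mean₂ := by
  have hQ : (0 : ℝ) < s.Q₂ := s.Q₂_pos
  have hR := s.residualVar_pos hN
  rw [mean₂_scores]
  refine mul_pos one_half_pos (Real.log_pos ((one_lt_div (by positivity)).2 ?_))
  exact mul_lt_mul (by linarith) (le_add_of_nonneg_right (by positivity)) hR (by positivity)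

end Scores

theorem half_rates_mem_capacityPartialFB (hN : 0 < N) (hQ₁ : s.Q₁ < P₁) (hQ₂ : s.Q₂ < P₂)
    {R₁ R₂ : ℝ} (hR₁ : 0 ≤ R₁) (hR₂ : 0 ≤ R₂) (h₁ : R₁ < (s.scores hN).mean₁)
    (h₂ : R₂ < (s.scores hN).mean₂) (h : R₁ + R₂ < (s.scores hN).mean) :
    (R₁ / 2, R₂ / 2) ∈ capacityPartialFB P₁ P₂ N σsq := by
  obtain ⟨c, size₁, size₂, error, energy⟩ := (s.scores hN).exists_blockCodes s.measurable_channel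
    (p := ![s.energy₁, s.energy₂])
    (Fin.forall_fin_two.2 ⟨s.measurable_energy₁, s.measurable_energy₂⟩)
    (Fin.forall_fin_two.2 ⟨s.integrable_energy₁, s.integrable_energy₂⟩) hR₁ hR₂ h₁ h₂ h
  refine ⟨by positivity, by positivity, fun δ hδ => ⟨fun n => s.code (c (n / 2)), ?_, ?_⟩⟩
  · filter_upwards [eventually_gt_atTop 0, eventually_rate_lt hR₁ hδ size₁,
      eventually_rate_lt hR₂ hδ size₂,
      eventually_lintegral_ofReal_sum_le s.integral_energy₁ hQ₁ (energy 0),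
      eventually_lintegral_ofReal_sum_le s.integral_energy₂ hQ₂ (energy 1)]
      with n hn rate₁ rate₂ energy₁ energy₂
    exact ⟨s.admissible_code _ hn energy₁ energy₂, rate₁, rate₂⟩
  · simp only [errorProb_code]
    exact error.comp (Nat.tendsto_div_const_atTop two_ne_zero)

end LinearScheme

theorem exists_mem_capacityPartialFB (P₁ P₂ N σsq : ℝ≥0) (hP₁ : 0 < P₁) (hP₂ : 0 < P₂)
    (hN : 0 < N) :
    ∃ R ∈ capacityPartialFB P₁ P₂ N σsq,
      (1 / 2 : ℝ) * Real.log (1 + ((P₁ : ℝ) + (P₂ : ℝ)) / (N : ℝ)) < R.1 + R.2 := by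
  obtain ⟨s, hQ₁, hQ₂, individual, joint⟩ := LinearScheme.exists_mean_gt hP₁ hP₂ hN σsq
  have hlog : 0 ≤ Real.log (1 + ((P₁ : ℝ) + P₂) / N) :=
    Real.log_nonneg (le_add_of_nonneg_right (by positivity))
  obtain ⟨R₁, R₂, hR₁, hR₂, h₁, h₂, h, hsum⟩ :=
    exists_rates (s.mean₁_scores_pos hN) (s.mean₂_scores_pos hN) hlog joint individual
  refine ⟨_, s.half_rates_mem_capacityPartialFB hN hQ₁ hQ₂ hR₁ hR₂ h₁ h₂ h, ?_⟩
  dsimp only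
  linarith

end GaussianMAC

theorem mainTheorem2 (P₁ P₂ N σsq : ℝ≥0) (hP₁ : 0 < P₁) (hP₂ : 0 < P₂) (hN : 0 < N) :
    GaussianMAC.capacityMAC P₁ P₂ N ⊂ GaussianMAC.capacityPartialFB P₁ P₂ N σsq ∧
    ∃ R ∈ GaussianMAC.capacityPartialFB P₁ P₂ N σsq,
      (1 / 2 : ℝ) * Real.log (1 + ((P₁ : ℝ) + (P₂ : ℝ)) / (N : ℝ)) < R.1 + R.2 := by
  obtain ⟨R, hR, hlt⟩ := GaussianMAC.exists_mem_capacityPartialFB P₁ P₂ N σsq hP₁ hP₂ hN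
  exact ⟨⟨GaussianMAC.capacityMAC_subset_capacityPartialFB P₁ P₂ N σsq, fun h =>
    absurd (GaussianMAC.add_le_of_mem_capacityMAC hN (h hR)) (not_le.2 hlt)⟩, R, hR, hlt⟩
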